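/- For $q\ge 1$ let $l^q=l^q(\mathbb Z)$ be the space of $f:\mathbb Z\to\mathbb R$ with $\|f\|_q=\big(\sum_{x\in\mathbb Z}|f(x)|^q\big)^{1/q}<\infty$, and let $\Delta u(j)=u(j+1)-2u(j)+u(j-1)$. For $0<s<1$ let $$(-\Delta)^s u=\frac1{\Gamma(-s)}\int_0^\infty\big(e^{t\Delta}u-u\big)\frac{dt}{t^{1+s}},\quad u\in l^2,$$ $$K_s(0)=0,\qquad K_s(m)=\frac{4^s\,\Gamma(1/2+s)}{\sqrt\pi\,|\Gamma(-s)|}\cdot\frac{\Gamma(|m|-s)}{\Gamma(|m|+1+s)}\quad(m\in\mathbb Z\setminus\{0\}),$$ $$|\widetilde\nabla u|(x)=\Big(\sum_{y\in\mathbb Z:\ |u(x)|>|u(y)|}K_s(y-x)\,[u(x)-u(y)]^2\Big)^{1/2},\quad x\in\mathbb Z.$$ For $V:\mathbb Z\to[0,\infty)$ let $L_V=(-\Delta)^s+V$ be the operator on $l^2$ defined by the quadratic form $(f,g)\mapsto\langle(-\Delta)^sf,g\rangle+\sum_{x}V(x)f(x)g(x)$ with domain $\{f\in l^2:\sum_x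 V(x)f(x)^2<\infty\}$. If $L_V$ generates a strongly continuous, contractive, symmetric, sub-Markovian semigroup $(e^{-tL_V})_{t\ge0}$ on $l^2$, set, for $f\in l^q$ with $1<q\le2$ (so that $f\in l^2$), $$\widetilde G_V(f)(x)=\Big(\int_0^\infty\Big(|\widetilde\nabla e^{-tL_V}f|^2(x)+\big|\sqrt{V(x)}\,e^{-tL_V}f(x)\big|^2\Big)\,dt\Big)^{1/2}\in[0,\infty].$$ **Statement.** For every $q\in(1,2]$ there is a constant $c_q>0$, depending only on $q$, such that for all $s\in(0,1)$ and all $V:\mathbb Z\to[0,\infty)$ for which $L_V$ generates a strongly continuous, contractive, symmetric, sub-Markovian semigroup on $l^2$, $$\|\widetilde G_V(f)\|_q\le c_q\|f\|_q\qquad\text{for all } f\in l^q.$$ -/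

import Mathlib

open scoped ENNReal Topology

noncomputable section

namespace FracSchrodinger

/-- The real Hilbert space `l²(ℤ)`. -/
abbrev l2 : Type := lp (fun _ : ℤ => ℝ) 2

/-- For `q ≤ 2`, the inclusion `l^q(ℤ) ⊂ l²(ℤ)`. -/
def toL2 {q : ℝ} (hq : q ≤ 2) (f : lp (fun _ : ℤ => ℝ) (ENNReal.ofReal q)) : l2 :=
  ⟨fun x => f x, (lp.memℓp f).of_exponent_ge (by
    simpa using ENNReal.ofReal_le_ofReal hq)⟩

/-- The `l^q(ℤ)`-norm of a function with values in `[0, ∞]`. -/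
def lqNorm (q : ℝ) (g : ℤ → ℝ≥0∞) : ℝ≥0∞ :=
  (∑' x : ℤ, g x ^ q) ^ (1 / q)

theorem memℓp_shift (k : ℤ) (f : l2) :
    Memℓp (fun x : ℤ => f (x + k) : ∀ _ : ℤ, ℝ) 2 := by
  have h := (memℓp_gen_iff (p := 2) (by norm_num)).1 (lp.memℓp f)
  exact (memℓp_gen_iff (p := 2) (by norm_num)).2 ((Equiv.addRight k).summable_iff.2 h)

/-- The translation `u ↦ u(· + k)` on `l²(ℤ)`. -/
def shift (k : ℤ) : l2 →L[ℝ] l2 :=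
  LinearMap.mkContinuous
    { toFun := fun f => ⟨fun x => f (x + k), memℓp_shift k f⟩
      map_add' := fun _ _ => rfl
      map_smul' := fun _ _ => rfl } 1 (by
    intro f
    rw [one_mul, lp.norm_eq_tsum_rpow (by norm_num), lp.norm_eq_tsum_rpow (by norm_num)]
    exact le_of_eq (congrArg (fun r : ℝ => r ^ (1 / (2 : ℝ≥0∞).toReal))
      ((Equiv.addRight k).tsum_eq (fun x : ℤ => ‖f x‖ ^ (2 : ℝ≥0∞).toReal))))

/-- The discrete Laplacian on `l²(ℤ)`. -/
def discreteLaplacian : l2 →L[ℝ] l2 :=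
  shift 1 - (2 : ℝ) • ContinuousLinearMap.id ℝ l2 + shift (-1)

theorem discreteLaplacian_apply (u : l2) (j : ℤ) :
    discreteLaplacian u j = u (j + 1) - 2 * u j + u (j - 1) := rfl

/-- The heat semigroup `e^{tΔ}` of the (bounded) discrete Laplacian on `l²(ℤ)`. -/
def heat (t : ℝ) : l2 →L[ℝ] l2 := NormedSpace.exp (t • discreteLaplacian)

/-- The fractional discrete Laplacian
`(-Δ)^s u = (1 / Γ(-s)) ∫₀^∞ (e^{tΔ} u - u) dt / t^{1+s}` on `l²(ℤ)`. For `0 < s < 1` the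
integrand is Bochner integrable for every `u`, and `(-Δ)^s` is a bounded operator. -/
def fracLaplacian (s : ℝ) (u : l2) : l2 :=
  (1 / Real.Gamma (-s)) • ∫ t in Set.Ioi (0 : ℝ), (1 / t ^ (1 + s)) • (heat t u - u)

/-- The kernel `K_s` on `ℤ`. -/
def kernel (s : ℝ) (m : ℤ) : ℝ :=
  if m = 0 then 0 else
    (4 ^ s * Real.Gamma (1 / 2 + s)) / (√Real.pi * |Real.Gamma (-s)|) *
      (Real.Gamma (|(m : ℝ)| - s) / Real.Gamma (|(m : ℝ)| + 1 + s))

/-- The modulus of the modified gradient,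
`(∑_{y : |u(x)| > |u(y)|} K_s(y - x) (u(x) - u(y))²)^{1/2}`, with values in `[0, ∞]`
(`K_s` is nonnegative for `0 < s < 1`). -/
def modGrad (s : ℝ) (u : ℤ → ℝ) (x : ℤ) : ℝ≥0∞ :=
  (∑' y : {y : ℤ // |u x| > |u y|},
    ENNReal.ofReal (kernel s (y - x) * (u x - u y) ^ 2)) ^ (1 / 2 : ℝ)

/-- The domain of the quadratic form of `(-Δ)^s + V`: as `(-Δ)^s` is bounded on `l²(ℤ)`,
it consists of the `f ∈ l²(ℤ)` with `∑ V f² < ∞`. -/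
def InFormDomain (V : ℤ → ℝ) (f : l2) : Prop :=
  Summable fun x : ℤ => V x * f x ^ 2

/-- The bilinear form `⟨(-Δ)^s f, g⟩ + ∑ V f g` of `(-Δ)^s + V`; for `V ≥ 0` the sum converges
absolutely when `f` and `g` are in the form domain. -/
def schrodingerForm (s : ℝ) (V : ℤ → ℝ) (f g : l2) : ℝ :=
  inner ℝ (fracLaplacian s f) g + ∑' x : ℤ, V x * f x * g x

/-- The graph of the operator `L_V = (-Δ)^s + V` on `l²(ℤ)`, in the sense of quadratic forms:
`f` is in the domain of `L_V` and `L_V f = g`. -/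
def IsSchrodingerOp (s : ℝ) (V : ℤ → ℝ) (f g : l2) : Prop :=
  InFormDomain V f ∧ ∀ φ : l2, InFormDomain V φ → schrodingerForm s V f φ = inner ℝ g φ

/-- `(P t)_{t ≥ 0}` is a strongly continuous, contractive, symmetric, sub-Markovian semigroup
on `l²(ℤ)` (the values `P t` with `t < 0` are irrelevant). -/
structure IsSymmSubMarkovSemigroup (P : ℝ → l2 →L[ℝ] l2) : Prop where
  map_zero : P 0 = ContinuousLinearMap.id ℝ l2
  map_add : ∀ r t : ℝ, 0 ≤ r → 0 ≤ t → P (r + t) = (P r).comp (P t)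
  strongly_continuous : ∀ f : l2, Filter.Tendsto (fun t => P t f) (𝓝[>] 0) (𝓝 f)
  contractive : ∀ t : ℝ, 0 ≤ t → ∀ f : l2, ‖P t f‖ ≤ ‖f‖
  symmetric : ∀ t : ℝ, 0 ≤ t → ∀ f g : l2, inner ℝ (P t f) g = inner ℝ f (P t g)
  sub_markovian : ∀ t : ℝ, 0 ≤ t → ∀ f : l2, (∀ x, 0 ≤ f x ∧ f x ≤ 1) →
    ∀ x, 0 ≤ P t f x ∧ P t f x ≤ 1

/-- The operator `L_V` generates `(P t)_{t ≥ 0}`, that is, `P t = e^{-t L_V}`: the infinitesimal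
generator of `(P t)_{t ≥ 0}` is `-L_V`, with equality of domains. -/
def IsGeneratedBy (P : ℝ → l2 →L[ℝ] l2) (s : ℝ) (V : ℤ → ℝ) : Prop :=
  ∀ f g : l2,
    Filter.Tendsto (fun t : ℝ => (1 / t) • (P t f - f)) (𝓝[>] 0) (𝓝 (-g)) ↔
      IsSchrodingerOp s V f g

/-- The Littlewood--Paley--Stein square function
`(∫₀^∞ (|∇̃ P_t f|² + |√V P_t f|²)(x) dt)^{1/2}`, with values in `[0, ∞]`. -/
def squareFunction (s : ℝ) (V : ℤ → ℝ) (P : ℝ → l2 →L[ℝ] l2) (f : l2) (x : ℤ) : ℝ≥0∞ :=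
  (∫⁻ t in Set.Ioi (0 : ℝ),
    (modGrad s (P t f) x ^ 2 + ENNReal.ofReal |√(V x) * P t f x| ^ 2)) ^ (1 / 2 : ℝ)

end FracSchrodinger

end

noncomputable section

namespace FracSchrodinger

/-! ### Elementary inequalities -/

/-! The argument is Stein's: differentiate `|u|^p` along the flow `u = P_t f` with `p = q`, and
control the remaining power of `u` by a maximal function. For finitely supported data the operator
has matrix entries `holding s + V x` on the diagonal and `-jump s (y - x)` off it. Differentiating
`|u(x)|^p` in time therefore produces the nonnegative Bregman remainders of `|·|^p` between `u(x)`
and `u(y)`, weighted by the jump rates, plus a potential term `V |u|^p`: this is `dissipation`. What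
is left is an outflow from `x` and an inflow into `x`. Their sums over `x` agree because the jump
rates are even and translation invariant, so the total dissipation over all times and sites is at
most `∑ |f|^p` (`tsum_lintegral_dissipation_le`). The bridge to the square function is pointwise. If
`|b| < |a|` and `1 < p ≤ 2`, then `(p - 1)^2 (a - b)^2` is at most `|a|^(2 - p)` times the Bregman
remainder (`sq_sub_le_bregman`). The modified gradient sums only over the sites with `|u(y)| <
|u(x)|`, exactly where this holds. Hence the square of the square function is at most a constant
times `(sup_t |P_t f|)^(2 - p)` times the time integral of the dissipation (`squareFunction_le`),
and Hölder with weights `1 - p/2` and `p/2` finishes the proof once the maximal function is bounded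
in `ℓ^p`. The maximal bound (`maximal_of_subMarkov`) combines Rota's dilation with Doob's
inequality: the even iterates of a symmetric Markov kernel are conditional expectations of a reverse
martingale on path space, and Doob's inequality is proved by induction on the path length with a
Burkholder function. It is applied to `P_t` on finer and finer time grids. Uniformity in `s` rests
on `kernel_le_jump`: `K_s` and the jump rates obey the same two-term recursion, so they need only be
compared at `m = 1`, with the absolute constant 4. -/

theorem abs_rpow_sub_two_mul_sq {p : ℝ} (hp : 1 < p) (a : ℝ) :
    |a| ^ (p - 2) * a * a = |a| ^ p := by
  rcases eq_or_ne a 0 with rfl | ha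
  · simp [Real.zero_rpow (by linarith : p ≠ 0)]
  · have : |a| ^ p = |a| ^ (p - 2) * |a| ^ (2 : ℝ) := by
      rw [← Real.rpow_add (abs_pos.2 ha)]; ring_nf
    rw [this, Real.rpow_two, sq_abs]; ring

/-- The Bregman remainder `|b|^p - |a|^p - (|·|^p)'(a) (b - a)`. -/
def bregman (p a b : ℝ) : ℝ := |b| ^ p + (p - 1) * |a| ^ p - p * |a| ^ (p - 2) * a * b

theorem bregman_eq_scaled {p : ℝ} (hp : 1 < p) {a : ℝ} (ha : a ≠ 0) (b : ℝ) :
    bregman p a b = |a| ^ p * (|b / a| ^ p + (p - 1) - p * (b / a)) := by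
  have h := abs_rpow_sub_two_mul_sq hp a
  have hb : b = a * (b / a) := by field_simp
  generalize b / a = c at hb
  subst hb
  rw [bregman, abs_mul, Real.mul_rpow (abs_nonneg _) (abs_nonneg _), ← h]
  ring

/-- By homogeneity this is Bernoulli's inequality for `|b / a|`, that is, convexity of `|·|^p`. -/
theorem bregman_nonneg {p : ℝ} (hp : 1 < p) (a b : ℝ) : 0 ≤ bregman p a b := by
  rcases eq_or_ne a 0 with rfl | ha
  · simp only [bregman, abs_zero, Real.zero_rpow (by linarith : p ≠ 0)]
    have := Real.rpow_nonneg (abs_nonneg b) p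
    simpa using this
  · rw [bregman_eq_scaled hp ha]
    refine mul_nonneg (Real.rpow_nonneg (abs_nonneg _) _) ?_
    generalize b / a = c
    have h := one_add_mul_self_le_rpow_one_add (s := |c| - 1)
      (by linarith [abs_nonneg c]) hp.le
    rw [add_sub_cancel] at h
    nlinarith [le_abs_self c]

theorem one_sub_sq_le_bregman {p : ℝ} (hp1 : 1 < p) (hp2 : p ≤ 2) {c : ℝ} (hc : |c| < 1) :
    (p - 1) ^ 2 * (1 - c) ^ 2 ≤ |c| ^ p + (p - 1) - p * c := by
  obtain ⟨h1, h2⟩ := abs_lt.1 hc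
  rcases le_or_gt 0 c with h0 | h0
  · rw [abs_of_nonneg h0]
    -- Since `0 ≤ 2 - p ≤ 1`, concavity of the power bounds `c^(2 - p)` by its tangent at 1.
    -- Dividing `c^2` by this bound gives a rational lower bound for `c^p`.
    have hD : c ^ (2 - p) ≤ 1 + (2 - p) * (c - 1) := by
      simpa using rpow_one_add_le_one_add_mul_self (s := c - 1) (by linarith)
        (by linarith : (0 : ℝ) ≤ 2 - p) (by linarith)
    have hX : c ^ 2 ≤ c ^ p * (1 + (2 - p) * (c - 1)) := by
      calc c ^ 2 = c ^ p * c ^ (2 - p) := by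
            rw [← Real.rpow_add_of_nonneg h0 (by linarith) (by linarith), ← Real.rpow_two]
            ring_nf
        _ ≤ _ := by gcongr
    have hDpos : 0 < 1 + (2 - p) * (c - 1) := by nlinarith
    -- The two sides differ exactly by `(2 - p) (p - 1)^2 (1 - c)^3`.
    have hpoly : ((p - 1) ^ 2 * (1 - c) ^ 2 - (p - 1) + p * c) * (1 + (2 - p) * (c - 1))
        ≤ c ^ 2 := by
      have : 0 ≤ (2 - p) * (p - 1) ^ 2 * (1 - c) ^ 3 := by
        have : 0 ≤ 1 - c := by linarith
        have : 0 ≤ 2 - p := by linarith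
        positivity
      nlinarith
    have := le_of_mul_le_mul_right (hpoly.trans hX) hDpos
    linarith
  · have h3 : |c| ^ (2 : ℝ) ≤ |c| ^ p :=
      Real.rpow_le_rpow_of_exponent_ge (abs_pos.2 h0.ne) hc.le hp2
    rw [Real.rpow_two, sq_abs] at h3
    have e1 : (p - 1) ^ 2 ≤ p - 1 := by nlinarith
    have e2 : 0 ≤ 1 - (p - 1) ^ 2 := by nlinarith
    have e3 : 0 ≤ p - 2 * (p - 1) ^ 2 := by nlinarith
    nlinarith [mul_nonneg e2 (sq_nonneg c), mul_nonneg e3 (neg_nonneg.2 h0.le)]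

/-- Quadratic lower bound for the Bregman remainder. -/
theorem sq_sub_le_bregman {p : ℝ} (hp1 : 1 < p) (hp2 : p ≤ 2) {a b : ℝ} (hab : |b| < |a|) :
    (p - 1) ^ 2 * (a - b) ^ 2 ≤ |a| ^ (2 - p) * bregman p a b := by
  have ha : a ≠ 0 := abs_pos.1 ((abs_nonneg b).trans_lt hab)
  have hc : |b / a| < 1 := by rwa [abs_div, div_lt_one (abs_pos.2 ha)]
  have h := one_sub_sq_le_bregman hp1 hp2 hc
  rw [bregman_eq_scaled hp1 ha, ← mul_assoc, ← Real.rpow_add (abs_pos.2 ha), sub_add_cancel,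
    Real.rpow_two, sq_abs]
  have e : a - b = a * (1 - b / a) := by field_simp
  rw [e]
  nlinarith [mul_le_mul_of_nonneg_left h (sq_nonneg a)]

/-! ### Hölder and Jensen inequalities for sums -/

theorem tsum_rpow_mul_rpow_le {ι : Type*} (f g : ι → ℝ≥0∞) {a b : ℝ} (ha : 0 ≤ a)
    (hb : 0 ≤ b) (hab : a + b = 1) :
    ∑' i, f i ^ a * g i ^ b ≤ (∑' i, f i) ^ a * (∑' i, g i) ^ b := by
  let _ : MeasurableSpace ι := ⊤
  have h := ENNReal.lintegral_mul_norm_pow_le (μ := MeasureTheory.Measure.count)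
    (f := f) (g := g) (Measurable.aemeasurable fun _ _ => trivial)
    (Measurable.aemeasurable fun _ _ => trivial) ha hb hab
  simpa only [MeasureTheory.lintegral_count] using h

/-- Jensen for weights of mass at most one, from Hölder applied to `w a = (w a^p)^(1/p) w^(1 -
1/p)`. -/
theorem tsum_mul_rpow_le {ι : Type*} (w a : ι → ℝ≥0∞) {p : ℝ} (hp : 1 ≤ p)
    (hw : ∑' i, w i ≤ 1) : (∑' i, w i * a i) ^ p ≤ ∑' i, w i * a i ^ p := by
  have hp0 : 0 < p := by linarith
  have h1 : 0 ≤ 1 - 1 / p := by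
    rw [sub_nonneg, div_le_one hp0]; exact hp
  have h := tsum_rpow_mul_rpow_le (fun i => w i * a i ^ p) w (a := 1 / p) (b := 1 - 1 / p)
    (by positivity) h1 (by ring)
  have e : ∀ i, (w i * a i ^ p) ^ (1 / p) * w i ^ (1 - 1 / p) = w i * a i := by
    intro i
    rw [ENNReal.mul_rpow_of_nonneg _ _ (by positivity), ← ENNReal.rpow_mul,
      mul_one_div_cancel hp0.ne', ENNReal.rpow_one, mul_right_comm,
      ← ENNReal.rpow_add_of_nonneg _ _ (by positivity) h1, add_sub_cancel, ENNReal.rpow_one]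
  simp only [e] at h
  calc (∑' i, w i * a i) ^ p
      ≤ ((∑' i, w i * a i ^ p) ^ (1 / p) * (∑' i, w i) ^ (1 - 1 / p)) ^ p := by gcongr
    _ ≤ ((∑' i, w i * a i ^ p) ^ (1 / p) * 1) ^ p := by
        gcongr
        exact ENNReal.rpow_le_one hw h1
    _ = _ := by
        rw [mul_one, ← ENNReal.rpow_mul, one_div_mul_cancel hp0.ne', ENNReal.rpow_one]

/-! ### The maximal inequality for symmetric Markov kernels -/

theorem rpow_sub_one_mul_self {p : ℝ} (hp : 1 < p) (m : ℝ≥0∞) : m ^ (p - 1) * m = m ^ p := by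
  conv_lhs => rw [← ENNReal.rpow_one m, ← ENNReal.rpow_mul, one_mul,
    ← ENNReal.rpow_add_of_nonneg _ _ (by linarith) zero_le_one, sub_add_cancel]

/-- The coefficient `2p / (p - 1)` of the Burkholder function. -/
def doobSlope (p : ℝ) : ℝ≥0∞ := ENNReal.ofReal (2 * p / (p - 1))

/-- A constant for the maximal inequality in `ℓ^p`. -/
def doobConst (p : ℝ) : ℝ≥0∞ := 1 + doobSlope p + doobSlope p ^ p

theorem doobConst_ne_top {p : ℝ} (hp : 1 < p) : doobConst p ≠ ⊤ := by
  have h : doobSlope p ≠ ⊤ := ENNReal.ofReal_ne_top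
  have h' : doobSlope p ^ p ≠ ⊤ := ENNReal.rpow_ne_top_of_nonneg (by linarith) h
  simp [doobConst, h, h']

/-- The difference of the sides is `2 / (p - 1)` times a Bregman remainder. Equivalently, `m ↦ 2 m^p
- doobSlope p * m^(p-1) x` is smallest at `m = x`; this is what fixes the slope `2p / (p - 1)`. -/
theorem doob_tangent {p : ℝ} (hp : 1 < p) {m x : ℝ≥0∞} (hm : m ≠ ⊤) (hx : x ≠ ⊤) :
    doobSlope p * (m ^ (p - 1) * x) + 2 * x ^ p ≤ 2 * m ^ p + doobSlope p * x ^ p := by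
  obtain ⟨a, ha, rfl⟩ : ∃ a : ℝ, 0 ≤ a ∧ m = ENNReal.ofReal a :=
    ⟨m.toReal, ENNReal.toReal_nonneg, (ENNReal.ofReal_toReal hm).symm⟩
  obtain ⟨b, hb, rfl⟩ : ∃ b : ℝ, 0 ≤ b ∧ x = ENNReal.ofReal b :=
    ⟨x.toReal, ENNReal.toReal_nonneg, (ENNReal.ofReal_toReal hx).symm⟩
  have hp1 : 0 < p - 1 := by linarith
  have h2 : (2 : ℝ≥0∞) = ENNReal.ofReal 2 := by simp
  have ea := Real.rpow_nonneg ha p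
  have eb := Real.rpow_nonneg hb p
  have ea1 := Real.rpow_nonneg ha (p - 1)
  rw [doobSlope, h2, ENNReal.ofReal_rpow_of_nonneg ha (by linarith : 0 ≤ p),
    ENNReal.ofReal_rpow_of_nonneg ha hp1.le, ENNReal.ofReal_rpow_of_nonneg hb (by linarith),
    ← ENNReal.ofReal_mul ea1, ← ENNReal.ofReal_mul (by positivity),
    ← ENNReal.ofReal_mul (by norm_num), ← ENNReal.ofReal_mul (by norm_num),
    ← ENNReal.ofReal_mul (by positivity), ← ENNReal.ofReal_add (by positivity) (by positivity),
    ← ENNReal.ofReal_add (by positivity) (by positivity)]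
  apply ENNReal.ofReal_le_ofReal
  have h := bregman_nonneg hp a b
  rw [bregman, abs_of_nonneg ha, abs_of_nonneg hb] at h
  have e : a ^ (p - 2) * a = a ^ (p - 1) := by
    rcases ha.eq_or_lt with rfl | ha
    · simp [Real.zero_rpow hp1.ne']
    · rw [← Real.rpow_add_one ha.ne']; ring_nf
  rw [mul_assoc p, e] at h
  have e2 : 2 * p / (p - 1) * (a ^ (p - 1) * b) + 2 * b ^ p - (2 * a ^ p + 2 * p / (p - 1) * b ^ p)
      = - (2 / (p - 1) * (b ^ p + (p - 1) * a ^ p - p * a ^ (p - 1) * b)) := by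
    field_simp; ring
  have : 0 ≤ 2 / (p - 1) * (b ^ p + (p - 1) * a ^ p - p * a ^ (p - 1) * b) := by positivity
  linarith

/-- Updating the running maximum from `m` to `m ⊔ x` does not increase the Burkholder function `2
m^p - doobSlope p * m^(p-1) x`. The inequality is written without subtraction, so finiteness is
needed to cancel. -/
theorem doob_step {p : ℝ} (hp : 1 < p) {m x W R : ℝ≥0∞} (hm : m ≠ ⊤) (hx : x ≠ ⊤)
    (h : W + doobSlope p * ((m ⊔ x) ^ (p - 1) * x) ≤ 2 * (m ⊔ x) ^ p + R) :
    W + doobSlope p * (m ^ (p - 1) * x) ≤ 2 * m ^ p + R := by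
  rcases le_total x m with hxm | hxm
  · rwa [sup_eq_left.2 hxm] at h
  · rw [sup_eq_right.2 hxm, rpow_sub_one_mul_self hp] at h
    have hb : doobSlope p ≠ ⊤ := ENNReal.ofReal_ne_top
    have hxp : x ^ p ≠ ⊤ := ENNReal.rpow_ne_top_of_nonneg (by linarith) hx
    have hfin : doobSlope p * x ^ p + 2 * x ^ p ≠ ⊤ :=
      ENNReal.add_ne_top.2 ⟨ENNReal.mul_ne_top hb hxp, ENNReal.mul_ne_top (by simp) hxp⟩
    refine (ENNReal.add_le_add_iff_right hfin).1 ?_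
    calc _ = (W + doobSlope p * x ^ p) + (doobSlope p * (m ^ (p - 1) * x) + 2 * x ^ p) := by ring
      _ ≤ (2 * x ^ p + R) + (2 * m ^ p + doobSlope p * x ^ p) := add_le_add h (doob_tangent hp hm hx)
      _ = _ := by ring

/-- Start of the induction. The factor 2 on the right leaves a spare `m^p`, which absorbs the mixed
term when `doobSlope p * x ≤ m`; otherwise `doobSlope p ^ p * x^p` does. -/
theorem doob_base {p : ℝ} (hp : 1 < p) (m x : ℝ≥0∞) :
    (m ⊔ x) ^ p + doobSlope p * (m ^ (p - 1) * x) ≤ 2 * m ^ p + doobConst p * x ^ p := by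
  have hp1 : 0 ≤ p - 1 := by linarith
  rcases le_total m x with h | h
  · rw [sup_eq_right.2 h]
    calc x ^ p + doobSlope p * (m ^ (p - 1) * x)
        ≤ x ^ p + doobSlope p * (x ^ (p - 1) * x) := by gcongr
      _ = (1 + doobSlope p) * x ^ p := by rw [rpow_sub_one_mul_self hp]; ring
      _ ≤ doobConst p * x ^ p := by gcongr; exact le_self_add
      _ ≤ _ := le_add_self
  · rw [sup_eq_left.2 h, two_mul, add_assoc]
    gcongr
    rcases le_total (doobSlope p * x) m with h' | h'
    · calc doobSlope p * (m ^ (p - 1) * x) = m ^ (p - 1) * (doobSlope p * x) := by ring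
        _ ≤ m ^ (p - 1) * m := by gcongr
        _ = m ^ p := rpow_sub_one_mul_self hp m
        _ ≤ _ := le_self_add
    · calc doobSlope p * (m ^ (p - 1) * x) = m ^ (p - 1) * (doobSlope p * x) := by ring
        _ ≤ (doobSlope p * x) ^ (p - 1) * (doobSlope p * x) := by gcongr
        _ = doobSlope p ^ p * x ^ p := by
          rw [rpow_sub_one_mul_self hp, ENNReal.mul_rpow_of_nonneg _ _ (by linarith)]
        _ ≤ doobConst p * x ^ p := by gcongr; exact le_add_self
        _ ≤ _ := le_add_self

section Kernels

variable {ι : Type*}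

/-- The operator with kernel `k`, acting on `[0, ∞]`-valued functions. -/
def kernelOp (k : ι → ι → ℝ≥0∞) (f : ι → ℝ≥0∞) (x : ι) : ℝ≥0∞ := ∑' y, k x y * f y

theorem kernelOp_mono {k k' : ι → ι → ℝ≥0∞} {f f' : ι → ℝ≥0∞} (hk : k ≤ k') (hf : f ≤ f') :
    kernelOp k f ≤ kernelOp k' f' :=
  fun x => ENNReal.tsum_le_tsum fun y => mul_le_mul' (hk x y) (hf y)

theorem tsum_kernelOp {k : ι → ι → ℝ≥0∞} (hsymm : ∀ x y, k x y = k y x) (f : ι → ℝ≥0∞) :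
    ∑' x, kernelOp k f x = ∑' y, (∑' x, k y x) * f y := by
  simp only [kernelOp]
  rw [ENNReal.tsum_comm]
  refine tsum_congr fun y => ?_
  rw [ENNReal.tsum_mul_right]
  simp only [hsymm]

theorem tsum_kernelOp_le {k : ι → ι → ℝ≥0∞} (hsymm : ∀ x y, k x y = k y x)
    (hsub : ∀ x, ∑' y, k x y ≤ 1) (f : ι → ℝ≥0∞) :
    ∑' x, kernelOp k f x ≤ ∑' x, f x := by
  rw [tsum_kernelOp hsymm]
  exact ENNReal.tsum_le_tsum fun y => mul_le_of_le_one_left' (hsub y)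

theorem tsum_kernelOp_iterate_le {k : ι → ι → ℝ≥0∞} (hsymm : ∀ x y, k x y = k y x)
    (hsub : ∀ x, ∑' y, k x y ≤ 1) (f : ι → ℝ≥0∞) (n : ℕ) :
    ∑' x, (kernelOp k)^[n] f x ≤ ∑' x, f x := by
  induction n with
  | zero => simp
  | succ n ih =>
    simp only [Function.iterate_succ_apply']
    exact (tsum_kernelOp_le hsymm hsub _).trans ih

theorem kernelOp_iterate_le_const {k : ι → ι → ℝ≥0∞} (hsub : ∀ x, ∑' y, k x y ≤ 1)
    {f : ι → ℝ≥0∞} {c : ℝ≥0∞} (hf : ∀ x, f x ≤ c) (n : ℕ) (x : ι) :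
    (kernelOp k)^[n] f x ≤ c := by
  induction n generalizing x with
  | zero => simpa using hf x
  | succ n ih =>
    rw [Function.iterate_succ_apply']
    calc kernelOp k ((kernelOp k)^[n] f) x ≤ ∑' y, k x y * c :=
          ENNReal.tsum_le_tsum fun y => by gcongr; exact ih y
      _ = (∑' y, k x y) * c := ENNReal.tsum_mul_right
      _ ≤ c := mul_le_of_le_one_left' (hsub x)

/-- The weight of a path for the kernel `k`. -/
def pathWeight (k : ι → ι → ℝ≥0∞) {N : ℕ} (x : Fin (N + 1) → ι) : ℝ≥0∞ :=
  ∏ i : Fin N, k (x i.castSucc) (x i.succ)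

/-- The running maximum of the functions `M n` along a path. -/
def pathMax (M : ℕ → ι → ℝ≥0∞) {N : ℕ} (x : Fin (N + 1) → ι) : ℝ≥0∞ :=
  ⨆ i : Fin (N + 1), M i (x i)

theorem pathWeight_cons (k : ι → ι → ℝ≥0∞) {N : ℕ} (a : ι) (x : Fin (N + 1) → ι) :
    pathWeight k (Fin.cons a x : Fin (N + 2) → ι) = k a (x 0) * pathWeight k x := by
  rw [pathWeight, Fin.prod_univ_succ]
  rfl

theorem pathWeight_snoc (k : ι → ι → ℝ≥0∞) {N : ℕ} (x : Fin (N + 1) → ι) (a : ι) :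
    pathWeight k (Fin.snoc x a : Fin (N + 2) → ι) = pathWeight k x * k (x (Fin.last N)) a := by
  rw [pathWeight, Fin.prod_univ_castSucc]
  simp only [Fin.snoc_castSucc, Fin.succ_last, Fin.snoc_last, pathWeight, ← Fin.castSucc_succ]

theorem pathMax_snoc (M : ℕ → ι → ℝ≥0∞) {N : ℕ} (x : Fin (N + 1) → ι) (a : ι) :
    pathMax M (Fin.snoc x a : Fin (N + 2) → ι) = pathMax M x ⊔ M (N + 1) a := by
  refine le_antisymm (iSup_le fun i => ?_) (sup_le (iSup_le fun i => ?_) ?_)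
  · refine Fin.lastCases ?_ (fun j => ?_) i
    · simp
    · simp only [Fin.snoc_castSucc, Fin.val_castSucc]
      exact le_sup_of_le_left (le_iSup (fun i : Fin (N + 1) => M i (x i)) j)
  · have := le_iSup (fun i : Fin (N + 2) => M i ((Fin.snoc x a : Fin (N + 2) → ι) i)) i.castSucc
    simpa only [Fin.snoc_castSucc, Fin.val_castSucc, pathMax] using this
  · have := le_iSup (fun i : Fin (N + 2) => M i ((Fin.snoc x a : Fin (N + 2) → ι) i)) (Fin.last _)
    simpa [pathMax] using this

theorem tsum_fin_cons {N : ℕ} (F : (Fin (N + 1) → ι) → ℝ≥0∞) :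
    ∑' x, F x = ∑' a, ∑' x : Fin N → ι, F (Fin.cons a x) := by
  rw [← (Fin.consEquiv fun _ => ι).tsum_eq, ENNReal.tsum_prod']
  rfl

theorem tsum_fin_snoc {N : ℕ} (F : (Fin (N + 1) → ι) → ℝ≥0∞) :
    ∑' x, F x = ∑' a, ∑' x : Fin N → ι, F (Fin.snoc x a) := by
  rw [← (Fin.snocEquiv fun _ => ι).tsum_eq, ENNReal.tsum_prod']
  rfl

/-- The law of the `i`-th step of the chain started at `a`. -/
theorem tsum_pathWeight_cons_mul {k : ι → ι → ℝ≥0∞} (hone : ∀ x, ∑' y, k x y = 1) {N : ℕ}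
    (a : ι) (i : Fin (N + 1)) (g : ι → ℝ≥0∞) :
    ∑' x : Fin N → ι, pathWeight k (Fin.cons a x : Fin (N + 1) → ι) *
      g ((Fin.cons a x : Fin (N + 1) → ι) i) = (kernelOp k)^[i] g a := by
  induction N generalizing a g with
  | zero =>
    obtain rfl : i = 0 := Fin.fin_one_eq_zero i
    rw [tsum_eq_single default fun b hb => (hb (Subsingleton.elim _ _)).elim]
    simp [pathWeight]
  | succ N ih =>
    rw [tsum_fin_cons]
    simp only [pathWeight_cons, Fin.cons_zero, mul_assoc, ENNReal.tsum_mul_left]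
    refine Fin.cases ?_ (fun j => ?_) i
    · have h := fun y => ih y 0 fun _ => g a
      simp only [Fin.val_zero, Function.iterate_zero_apply] at h
      simp only [Fin.cons_zero, h, ENNReal.tsum_mul_right, hone, one_mul]
      simp
    · simp only [Fin.cons_succ, ih, Fin.val_succ, Function.iterate_succ_apply']
      rfl

/-- Read from its endpoint `z` backwards, a path is again a chain with kernel `k`, by symmetry, and
`(kernelOp k)^[n] f (x n)` is a martingale in this direction. Here `m` records the maximum over the
part of the path already read, so the induction must allow every finite `m`; `m = 0` gives Doob's
inequality. -/
theorem doob_maximal_last {k : ι → ι → ℝ≥0∞} (hsymm : ∀ x y, k x y = k y x)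
    (hone : ∀ x, ∑' y, k x y = 1) {p : ℝ} (hp : 1 < p) {f : ι → ℝ≥0∞} {c : ℝ≥0∞}
    (hc : c ≠ ⊤) (hf : ∀ x, f x ≤ c) (N : ℕ) (z : ι) {m : ℝ≥0∞} (hm : m ≠ ⊤) :
    ∑' x : Fin N → ι, pathWeight k (Fin.snoc x z : Fin (N + 1) → ι) *
        (m ⊔ pathMax (fun n => (kernelOp k)^[n] f) (Fin.snoc x z : Fin (N + 1) → ι)) ^ p
      + doobSlope p * (m ^ (p - 1) * (kernelOp k)^[N] f z)
      ≤ 2 * m ^ p + doobConst p * (kernelOp k)^[N] (fun x => f x ^ p) z := by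
  have hfin : ∀ n x, (kernelOp k)^[n] f x ≠ ⊤ := fun n x =>
    ne_top_of_le_ne_top hc (kernelOp_iterate_le_const (fun x => (hone x).le) hf n x)
  induction N generalizing z m with
  | zero =>
    rw [tsum_eq_single default fun b hb => (hb (Subsingleton.elim _ _)).elim]
    have e : pathMax (fun n => (kernelOp k)^[n] f) (Fin.snoc default z : Fin 1 → ι) = f z := by
      simp [pathMax, Fin.snoc]
    simpa [e, pathWeight] using doob_base hp m (f z)
  | succ N ih =>
    refine doob_step hp hm (hfin _ _) ?_
    -- The endpoint is read first: its value enters the running maximum, and the remaining path ends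
    -- at a site `y` chosen with weight `k z y`.
    set m' := m ⊔ (kernelOp k)^[N + 1] f z with hm'
    have hm't : m' ≠ ⊤ := by
      rw [hm']
      exact (max_lt (lt_top_iff_ne_top.2 hm) (lt_top_iff_ne_top.2 (hfin _ _))).ne
    rw [tsum_fin_snoc]
    have e : ∀ (y : ι) (x : Fin N → ι),
        pathWeight k (Fin.snoc (Fin.snoc x y : Fin (N + 1) → ι) z : Fin (N + 2) → ι) *
        (m ⊔ pathMax (fun n => (kernelOp k)^[n] f)
          (Fin.snoc (Fin.snoc x y : Fin (N + 1) → ι) z : Fin (N + 2) → ι)) ^ p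
        = k z y * (pathWeight k (Fin.snoc x y : Fin (N + 1) → ι) *
          (m' ⊔ pathMax (fun n => (kernelOp k)^[n] f) (Fin.snoc x y : Fin (N + 1) → ι)) ^ p) := by
      intro y x
      rw [pathWeight_snoc, pathMax_snoc, Fin.snoc_last, hsymm y z, hm', sup_right_comm,
        sup_assoc m]
      ring
    simp only [e, ENNReal.tsum_mul_left, Function.iterate_succ_apply']
    calc _ = ∑' y, k z y * (∑' x : Fin N → ι, pathWeight k (Fin.snoc x y : Fin (N + 1) → ι) *
          (m' ⊔ pathMax (fun n => (kernelOp k)^[n] f) (Fin.snoc x y : Fin (N + 1) → ι)) ^ p +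
            doobSlope p * (m' ^ (p - 1) * (kernelOp k)^[N] f y)) := by
          simp only [mul_add, ENNReal.tsum_add]
          congr 1
          rw [kernelOp, ← ENNReal.tsum_mul_left, ← ENNReal.tsum_mul_left]
          exact tsum_congr fun y => by ring
      _ ≤ ∑' y, k z y * (2 * m' ^ p + doobConst p * (kernelOp k)^[N] (fun x => f x ^ p) y) :=
          ENNReal.tsum_le_tsum fun y => mul_le_mul_right (ih y hm't) _
      _ = _ := by
          simp only [mul_add, ENNReal.tsum_add, ENNReal.tsum_mul_right, hone, one_mul]
          congr 1
          rw [kernelOp, ← ENNReal.tsum_mul_left]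
          exact tsum_congr fun y => by ring

theorem doob_maximal {k : ι → ι → ℝ≥0∞} (hsymm : ∀ x y, k x y = k y x)
    (hone : ∀ x, ∑' y, k x y = 1) {p : ℝ} (hp : 1 < p) {f : ι → ℝ≥0∞} {c : ℝ≥0∞}
    (hc : c ≠ ⊤) (hf : ∀ x, f x ≤ c) (N : ℕ) :
    ∑' x : Fin (N + 1) → ι, pathWeight k x * pathMax (fun n => (kernelOp k)^[n] f) x ^ p
      ≤ doobConst p * ∑' x, f x ^ p := by
  rw [tsum_fin_snoc]
  calc _ ≤ ∑' z, doobConst p * (kernelOp k)^[N] (fun x => f x ^ p) z := by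
        refine ENNReal.tsum_le_tsum fun z => ?_
        have h := doob_maximal_last hsymm hone hp hc hf N z (m := 0) (by simp)
        simpa [ENNReal.zero_rpow_of_pos (by linarith : 0 < p),
          ENNReal.zero_rpow_of_pos (by linarith : 0 < p - 1)] using h
    _ ≤ _ := by
        rw [ENNReal.tsum_mul_left]
        exact mul_le_mul_right (tsum_kernelOp_iterate_le hsymm (fun x => (hone x).le) _ N) _

/-- Rota's dilation: given the starting point `a`, the mean of `(kernelOp k)^[n] f (x n)` is
`(kernelOp k)^[2 * n] f a`. The supremum over `n` is thus at most the conditional mean of the path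
maximum, and Jensen followed by `doob_maximal` applies. Only even iterates arise this way. -/
theorem maximal_of_markov {k : ι → ι → ℝ≥0∞} (hsymm : ∀ x y, k x y = k y x)
    (hone : ∀ x, ∑' y, k x y = 1) {p : ℝ} (hp : 1 < p) (f : ι → ℝ≥0∞) (N : ℕ) :
    ∑' x, (⨆ n : Fin (N + 1), (kernelOp k)^[2 * n] f x) ^ p
      ≤ doobConst p * ∑' x, f x ^ p := by
  have hp0 : 0 < p := by linarith
  by_cases htop : ∑' x, f x ^ p = ⊤
  · rw [htop, ENNReal.mul_top (by simp [doobConst])]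
    exact le_top
  have hc : (∑' x, f x ^ p) ^ (1 / p) ≠ ⊤ :=
    ENNReal.rpow_ne_top_of_nonneg (by positivity) htop
  have hf : ∀ x, f x ≤ (∑' x, f x ^ p) ^ (1 / p) := fun x => by
    rw [one_div, ENNReal.le_rpow_inv_iff hp0]
    exact ENNReal.le_tsum x
  refine le_trans ?_ (doob_maximal hsymm hone hp hc hf N)
  rw [tsum_fin_cons]
  refine ENNReal.tsum_le_tsum fun a => ?_
  have hw : ∑' x : Fin N → ι, pathWeight k (Fin.cons a x : Fin (N + 1) → ι) ≤ 1 := by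
    have := tsum_pathWeight_cons_mul hone a (0 : Fin (N + 1)) fun _ => 1
    simpa using this.le
  refine le_trans ?_ (tsum_mul_rpow_le _ _ hp.le hw)
  gcongr
  refine iSup_le fun n => ?_
  rw [two_mul, Function.iterate_add_apply, ← tsum_pathWeight_cons_mul hone a n]
  refine ENNReal.tsum_le_tsum fun x => ?_
  gcongr
  exact le_iSup (fun i : Fin (N + 1) =>
    (kernelOp k)^[i] f ((Fin.cons a x : Fin (N + 1) → ι) i)) n

/-- Stein's maximal inequality for the even powers of a symmetric sub-Markovian kernel. -/
theorem maximal_of_subMarkov {k : ι → ι → ℝ≥0∞} (hsymm : ∀ x y, k x y = k y x)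
    (hsub : ∀ x, ∑' y, k x y ≤ 1) {p : ℝ} (hp : 1 < p) (f : ι → ℝ≥0∞) (N : ℕ) :
    ∑' x, (⨆ n : Fin (N + 1), (kernelOp k)^[2 * n] f x) ^ p
      ≤ doobConst p * ∑' x, f x ^ p := by
  classical
  -- The missing mass is put on the diagonal, which keeps the kernel symmetric, makes it Markov, and
  -- only increases the iterates.
  set k' : ι → ι → ℝ≥0∞ := fun x y => k x y + if y = x then 1 - ∑' z, k x z else 0 with hk'
  have hone : ∀ x, ∑' y, k' x y = 1 := fun x => by
    simp only [hk', ENNReal.tsum_add, tsum_ite_eq]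
    exact add_tsub_cancel_of_le (hsub x)
  have hsymm' : ∀ x y, k' x y = k' y x := fun x y => by
    rcases eq_or_ne x y with rfl | h
    · rfl
    · simp [hk', hsymm x y, h, h.symm]
  have hle : k ≤ k' := fun x y => le_self_add
  have hit : ∀ n, (kernelOp k)^[n] f ≤ (kernelOp k')^[n] f := fun n => by
    induction n with
    | zero => exact le_rfl
    | succ n ih =>
      rw [Function.iterate_succ_apply', Function.iterate_succ_apply']
      exact kernelOp_mono hle ih
  refine le_trans (ENNReal.tsum_le_tsum fun x => ?_) (maximal_of_markov hsymm' hone hp f N)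
  gcongr
  exact hit _ x

end Kernels

open Filter Set MeasureTheory

/-! ### Symmetric sub-Markovian semigroups on `l²(ℤ)` -/

/-- The unit vector at `x`. -/
def unit (x : ℤ) : l2 := lp.single 2 x (1 : ℝ)

theorem unit_apply (x y : ℤ) : unit x y = if y = x then 1 else 0 := by
  rw [unit, lp.single_apply]
  simp [Pi.single_apply]

theorem inner_unit (f : l2) (x : ℤ) : inner ℝ f (unit x) = f x := by
  rw [unit, lp.inner_single_right]
  simp

theorem unit_inner (f : l2) (x : ℤ) : inner ℝ (unit x) f = f x := by
  rw [real_inner_comm, inner_unit]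

theorem hasSum_mul_inner (f g : l2) : HasSum (fun y => f y * g y) (inner ℝ f g) := by
  have h := lp.hasSum_inner (𝕜 := ℝ) f g
  simpa only [real_inner_eq_re_inner, RCLike.inner_apply, conj_trivial, RCLike.re_to_real, mul_comm]
    using h

theorem abs_apply_le_norm (f : l2) (x : ℤ) : |f x| ≤ ‖f‖ := by
  simpa using lp.norm_apply_le_norm (by norm_num) f x

namespace IsSymmSubMarkovSemigroup

variable {P : ℝ → l2 →L[ℝ] l2} (hP : IsSymmSubMarkovSemigroup P)
include hP

theorem apply_eq_inner {t : ℝ} (ht : 0 ≤ t) (f : l2) (x : ℤ) :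
    P t f x = inner ℝ f (P t (unit x)) := by
  rw [← hP.symmetric t ht, inner_unit]

theorem unit_symm {t : ℝ} (ht : 0 ≤ t) (x y : ℤ) : P t (unit x) y = P t (unit y) x := by
  rw [hP.apply_eq_inner ht, unit_inner]

theorem unit_nonneg {t : ℝ} (ht : 0 ≤ t) (x y : ℤ) : 0 ≤ P t (unit x) y := by
  refine (hP.sub_markovian t ht (unit x) (fun z => ?_) y).1
  rw [unit_apply]
  split_ifs <;> norm_num

theorem sum_unit_le_one {t : ℝ} (ht : 0 ≤ t) (x : ℤ) (F : Finset ℤ) :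
    ∑ y ∈ F, P t (unit x) y ≤ 1 := by
  have h1 : ∀ z : ℤ, (∑ y ∈ F, unit y : l2) z = if z ∈ F then 1 else 0 := fun z => by
    rw [lp.coeFn_sum, Finset.sum_apply]
    simp [unit_apply]
  have h := (hP.sub_markovian t ht (∑ y ∈ F, unit y) (fun z => by
    rw [h1]; split_ifs <;> norm_num) x).2
  rw [map_sum, lp.coeFn_sum, Finset.sum_apply] at h
  simpa only [hP.unit_symm ht x] using h

end IsSymmSubMarkovSemigroup

/-- The transition kernel of the semigroup. -/
def transition (P : ℝ → l2 →L[ℝ] l2) (t : ℝ) (x y : ℤ) : ℝ≥0∞ := ENNReal.ofReal (P t (unit x) y)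

namespace IsSymmSubMarkovSemigroup

variable {P : ℝ → l2 →L[ℝ] l2} (hP : IsSymmSubMarkovSemigroup P)
include hP

theorem transition_symm {t : ℝ} (ht : 0 ≤ t) (x y : ℤ) :
    transition P t x y = transition P t y x := by
  rw [transition, hP.unit_symm ht, transition]

theorem tsum_transition_le {t : ℝ} (ht : 0 ≤ t) (x : ℤ) : ∑' y, transition P t x y ≤ 1 := by
  rw [ENNReal.tsum_eq_iSup_sum]
  refine iSup_le fun F => ?_
  simp only [transition]
  rw [← ENNReal.ofReal_sum_of_nonneg fun y _ => hP.unit_nonneg ht x y]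
  simpa using ENNReal.ofReal_le_ofReal (hP.sum_unit_le_one ht x F)

theorem ofReal_abs_apply_le {t : ℝ} (ht : 0 ≤ t) (f : l2) (x : ℤ) :
    ENNReal.ofReal |P t f x| ≤ kernelOp (transition P t) (fun y => ENNReal.ofReal |f y|) x := by
  have h := hasSum_mul_inner f (P t (unit x))
  rw [hP.apply_eq_inner ht, ← h.tsum_eq]
  have habs := h.summable.abs
  calc ENNReal.ofReal |∑' y, f y * P t (unit x) y|
      ≤ ENNReal.ofReal (∑' y, |f y * P t (unit x) y|) :=
        ENNReal.ofReal_le_ofReal (norm_tsum_le_tsum_norm (f := fun y => f y * P t (unit x) y) habs)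
    _ = ∑' y, ENNReal.ofReal |f y * P t (unit x) y| :=
        ENNReal.ofReal_tsum_of_nonneg (fun _ => abs_nonneg _) habs
    _ = _ := tsum_congr fun y => by
        rw [abs_mul, abs_of_nonneg (hP.unit_nonneg ht x y), mul_comm,
          ENNReal.ofReal_mul (hP.unit_nonneg ht x y), transition]

/-- Jensen in each row of the kernel, then the column sums, which symmetry bounds by one. -/
theorem tsum_rpow_apply_le {t : ℝ} (ht : 0 ≤ t) {p : ℝ} (hp : 1 ≤ p) (f : l2) :
    ∑' x, ENNReal.ofReal |P t f x| ^ p ≤ ∑' x, ENNReal.ofReal |f x| ^ p :=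
  calc _ ≤ ∑' x, kernelOp (transition P t) (fun y => ENNReal.ofReal |f y| ^ p) x := by
        refine ENNReal.tsum_le_tsum fun x => le_trans ?_
          (tsum_mul_rpow_le _ _ hp (hP.tsum_transition_le ht x))
        gcongr
        exact hP.ofReal_abs_apply_le ht f x
    _ ≤ _ := tsum_kernelOp_le (hP.transition_symm ht) (hP.tsum_transition_le ht) _

theorem ofReal_abs_apply_le_iterate {t : ℝ} (ht : 0 ≤ t) (f : l2) (n : ℕ) :
    ∀ x, ENNReal.ofReal |P (n * t) f x| ≤
      (kernelOp (transition P t))^[n] (fun y => ENNReal.ofReal |f y|) x := by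
  induction n with
  | zero => simp [hP.map_zero]
  | succ n ih =>
    intro x
    have e : ((n + 1 : ℕ) : ℝ) * t = t + n * t := by push_cast; ring
    rw [e, hP.map_add t (n * t) ht (by positivity), Function.iterate_succ_apply']
    exact (hP.ofReal_abs_apply_le ht _ x).trans (kernelOp_mono le_rfl ih x)

theorem continuousOn_apply (f : l2) : ContinuousOn (fun t => P t f) (Ici 0) := by
  -- Strong continuity at zero spreads to all times by contractivity and the semigroup law.
  have key : ∀ r t : ℝ, 0 ≤ r → 0 ≤ t → ‖P t f - P r f‖ ≤ ‖P |t - r| f - f‖ := by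
    have h1 : ∀ r t : ℝ, 0 ≤ r → r ≤ t → ‖P t f - P r f‖ ≤ ‖P (t - r) f - f‖ := by
      intro r t hr hrt
      have h := hP.map_add r (t - r) hr (by linarith)
      rw [add_sub_cancel] at h
      rw [h, ContinuousLinearMap.comp_apply, ← map_sub]
      exact hP.contractive r hr _
    intro r t hr ht
    rcases le_total r t with h | h
    · rw [abs_of_nonneg (by linarith)]
      exact h1 r t hr h
    · rw [abs_sub_comm, abs_of_nonneg (by linarith), norm_sub_rev]
      exact h1 t r ht h
  have h0 : Tendsto (fun t => P t f) (𝓝[≥] 0) (𝓝 f) := by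
    have : ContinuousWithinAt (fun t => P t f) (Ioi 0) 0 := by
      simpa [ContinuousWithinAt, hP.map_zero] using hP.strongly_continuous f
    simpa [ContinuousWithinAt, hP.map_zero] using continuousWithinAt_Ioi_iff_Ici.1 this
  intro r hr
  have habs : Tendsto (fun t : ℝ => |t - r|) (𝓝[Ici 0] r) (𝓝[≥] 0) := by
    refine tendsto_nhdsWithin_iff.2 ⟨?_, Eventually.of_forall fun t => mem_Ici.2 (abs_nonneg _)⟩
    have : Continuous fun t : ℝ => |t - r| := by fun_prop
    simpa using (this.tendsto r).mono_left nhdsWithin_le_nhds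
  have h2 : Tendsto (fun t => ‖P |t - r| f - f‖) (𝓝[Ici 0] r) (𝓝 0) :=
    tendsto_iff_norm_sub_tendsto_zero.1 (h0.comp habs)
  rw [ContinuousWithinAt, tendsto_iff_norm_sub_tendsto_zero]
  refine tendsto_of_tendsto_of_tendsto_of_le_of_le' tendsto_const_nhds h2 ?_ ?_
  · exact Eventually.of_forall fun _ => norm_nonneg _
  · filter_upwards [self_mem_nhdsWithin] with t ht
    exact key r t hr ht

theorem continuous_max (f : l2) : Continuous fun t => P (max t 0) f :=
  (hP.continuousOn_apply f).comp_continuous (by fun_prop) fun _ => mem_Ici.2 (le_max_right _ _)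

end IsSymmSubMarkovSemigroup

theorem continuous_apply_l2 (x : ℤ) : Continuous fun f : l2 => f x := by
  have : (fun f : l2 => f x) = fun f : l2 => inner ℝ f (unit x) := by
    ext f; rw [inner_unit]
  rw [this]
  fun_prop

/-! ### Maximal inequality for the semigroup -/

/-- A maximal function of the semigroup, over an increasingly fine set of times. -/
def maximalFun (P : ℝ → l2 →L[ℝ] l2) (f : l2) (x : ℤ) : ℝ≥0∞ :=
  liminf (fun N : ℕ => ⨆ n : Fin ((N + 1) ^ 2 + 1),
    ENNReal.ofReal |P ((2 * n : ℕ) * (1 / (N + 1))) f x|) atTop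

namespace IsSymmSubMarkovSemigroup

variable {P : ℝ → l2 →L[ℝ] l2} (hP : IsSymmSubMarkovSemigroup P)
include hP

theorem tsum_maximalFun_rpow_le {p : ℝ} (hp : 1 < p) (f : l2) :
    ∑' x, maximalFun P f x ^ p ≤ doobConst p * ∑' x, ENNReal.ofReal |f x| ^ p := by
  have hp0 : 0 < p := by linarith
  have e : ∀ x, maximalFun P f x ^ p = liminf (fun N : ℕ => (⨆ n : Fin ((N + 1) ^ 2 + 1),
      ENNReal.ofReal |P ((2 * n : ℕ) * (1 / (N + 1))) f x|) ^ p) atTop := fun x =>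
    (ENNReal.orderIsoRpow p hp0).liminf_apply
  simp only [e]
  rw [← MeasureTheory.lintegral_count]
  -- The grids for different `N` are not nested, so Fatou's lemma replaces monotone convergence;
  -- this is why the maximal function is a lower limit.
  refine (MeasureTheory.lintegral_liminf_le fun N => measurable_from_top).trans ?_
  refine liminf_le_of_le (by isBoundedDefault) fun b hb => ?_
  obtain ⟨N, hN⟩ := hb.exists
  refine hN.trans ?_
  rw [MeasureTheory.lintegral_count]
  have hd : (0 : ℝ) ≤ 1 / (N + 1) := by positivity
  refine le_trans (ENNReal.tsum_le_tsum fun x => ?_)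
    (maximal_of_subMarkov (hP.transition_symm hd) (hP.tsum_transition_le hd) hp _ ((N + 1) ^ 2))
  gcongr
  exact hP.ofReal_abs_apply_le_iterate hd f _ x

theorem ofReal_abs_apply_le_maximalFun {t : ℝ} (ht : 0 ≤ t) (f : l2) (x : ℤ) :
    ENNReal.ofReal |P t f x| ≤ maximalFun P f x := by
  -- The largest even multiple of `1 / (N + 1)` not exceeding `t`. It lies in the `N`-th grid as
  -- soon as `t ≤ N`.
  set τ : ℕ → ℝ := fun N => (2 * ⌊t * (N + 1) / 2⌋₊ : ℕ) * (1 / (N + 1)) with hτ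
  have hτ0 : ∀ N, τ N ∈ Ici (0 : ℝ) := fun N => by
    simp only [hτ, mem_Ici]; positivity
  have hfl : ∀ N : ℕ, |τ N - t| ≤ 2 * (1 / ((N : ℝ) + 1)) := fun N => by
    have hN : (0 : ℝ) < N + 1 := by positivity
    have h1 := Nat.floor_le (show 0 ≤ t * (N + 1) / 2 by positivity)
    have h2 := (Nat.lt_floor_add_one (t * (N + 1) / 2)).le
    have e : τ N - t = (2 * ⌊t * (N + 1) / 2⌋₊ - t * (N + 1)) * (1 / (N + 1)) := by
      simp only [hτ]; push_cast; field_simp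
    rw [e, abs_mul, abs_of_pos (one_div_pos.2 hN)]
    gcongr
    rw [abs_le]; constructor <;> linarith
  have hτt : Tendsto τ atTop (𝓝[Ici 0] t) := by
    refine tendsto_nhdsWithin_iff.2 ⟨?_, Eventually.of_forall hτ0⟩
    rw [tendsto_iff_norm_sub_tendsto_zero]
    refine squeeze_zero (fun _ => norm_nonneg _) hfl ?_
    simpa using (tendsto_one_div_add_atTop_nhds_zero_nat (𝕜 := ℝ)).const_mul 2
  have hlim : Tendsto (fun N => ENNReal.ofReal |P (τ N) f x|) atTop
      (𝓝 (ENNReal.ofReal |P t f x|)) :=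
    (ENNReal.continuous_ofReal.comp (continuous_abs.comp (continuous_apply_l2 x))).continuousAt.tendsto.comp
      ((hP.continuousOn_apply f t ht).tendsto.comp hτt)
  rw [← hlim.liminf_eq]
  refine liminf_le_liminf ?_
  obtain ⟨N₀, hN₀⟩ := exists_nat_ge t
  filter_upwards [eventually_ge_atTop N₀] with N hN
  have hle : ⌊t * (N + 1) / 2⌋₊ < (N + 1) ^ 2 + 1 := by
    refine Nat.lt_succ_of_le (Nat.floor_le_of_le ?_)
    have : t ≤ N := hN₀.trans (by exact_mod_cast hN)
    push_cast
    nlinarith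
  exact le_iSup (fun n : Fin ((N + 1) ^ 2 + 1) =>
    ENNReal.ofReal |P ((2 * n : ℕ) * (1 / (N + 1))) f x|) ⟨_, hle⟩

end IsSymmSubMarkovSemigroup

/-! ### The heat kernel of the discrete Laplacian -/

theorem norm_exp_le_exp_norm (a : l2 →L[ℝ] l2) : ‖NormedSpace.exp a‖ ≤ Real.exp ‖a‖ := by
  have h1 := NormedSpace.exp_series_hasSum_exp' (𝕂 := ℝ) a
  have h2 := NormedSpace.exp_series_hasSum_exp' (𝕂 := ℝ) ‖a‖
  rw [← Real.exp_eq_exp_ℝ] at h2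
  rw [← h1.tsum_eq]
  refine tsum_of_norm_bounded h2 fun n => ?_
  rw [norm_smul, smul_eq_mul, Real.norm_of_nonneg (by positivity)]
  gcongr
  rcases n.eq_zero_or_pos with rfl | hn
  · rw [pow_zero, pow_zero]; exact ContinuousLinearMap.norm_id_le
  · exact norm_pow_le' a hn

theorem shift_apply (k : ℤ) (f : l2) (x : ℤ) : shift k f x = f (x + k) := rfl

theorem norm_shift_le (k : ℤ) : ‖shift k‖ ≤ 1 :=
  LinearMap.mkContinuous_norm_le _ zero_le_one _

theorem shift_pow_apply (k : ℤ) (n : ℕ) (f : l2) (x : ℤ) :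
    ((shift k) ^ n) f x = f (x + n * k) := by
  induction n generalizing x with
  | zero => simp
  | succ n ih =>
    rw [pow_succ', mul_apply_eq_comp, shift_apply, ih]
    push_cast; ring_nf

theorem commute_shift (k l : ℤ) : Commute (shift k) (shift l) := by
  ext f x
  simp only [mul_apply_eq_comp, shift_apply]
  ring_nf

theorem heat_eq (t : ℝ) : heat t = Real.exp (-(2 * t)) •
    (NormedSpace.exp (t • shift 1) * NormedSpace.exp (t • shift (-1))) := by
  let _ : NormedAlgebra ℚ (l2 →L[ℝ] l2) := NormedAlgebra.restrictScalars ℚ ℝ _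
  have e : t • discreteLaplacian = algebraMap ℝ (l2 →L[ℝ] l2) (-(2 * t)) +
      (t • shift 1 + t • shift (-1)) := by
    rw [discreteLaplacian, Algebra.algebraMap_eq_smul_one, ContinuousLinearMap.one_def]
    module
  rw [heat, e, NormedSpace.exp_add_of_commute (Algebra.commutes _ _),
    NormedSpace.exp_add_of_commute (((commute_shift 1 (-1)).smul_left t).smul_right t),
    ← NormedSpace.algebraMap_exp_comm, ← Real.exp_eq_exp_ℝ, ← Algebra.smul_def]

/-- The exponentials of the two shifts have norm at most `e^t` each, which the factor `e^(-2t)`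
cancels. -/
theorem norm_heat_le {t : ℝ} (ht : 0 ≤ t) : ‖heat t‖ ≤ 1 := by
  have h : ∀ k, ‖NormedSpace.exp (t • shift k)‖ ≤ Real.exp t := fun k => by
    refine (norm_exp_le_exp_norm _).trans (Real.exp_le_exp.2 ?_)
    rw [norm_smul, Real.norm_of_nonneg ht]
    exact mul_le_of_le_one_right ht (norm_shift_le k)
  rw [heat_eq, norm_smul, Real.norm_of_nonneg (Real.exp_pos _).le]
  calc _ ≤ Real.exp (-(2 * t)) * (Real.exp t * Real.exp t) := by
        gcongr
        exact (norm_mul_le _ _).trans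
          (mul_le_mul (h 1) (h (-1)) (norm_nonneg _) (Real.exp_pos _).le)
    _ = 1 := by rw [← Real.exp_add, ← Real.exp_add, ← Real.exp_zero]; ring_nf

theorem hasDerivAt_heat (t : ℝ) : HasDerivAt heat (discreteLaplacian * heat t) t :=
  hasDerivAt_exp_smul_const' discreteLaplacian t

theorem hasDerivAt_heat_apply (t : ℝ) (u : l2) :
    HasDerivAt (fun t => heat t u) (discreteLaplacian (heat t u)) t :=
  (hasDerivAt_heat t).clm_apply (hasDerivAt_const t u) |>.congr_deriv (by simp)

theorem heat_zero : heat 0 = 1 := by simp [heat]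

theorem norm_heat_sub_le {t : ℝ} (ht : 0 ≤ t) (u : l2) :
    ‖heat t u - u‖ ≤ ‖discreteLaplacian‖ * ‖u‖ * t := by
  have h := norm_image_sub_le_of_norm_deriv_le_segment' (f := fun t => heat t u) (a := 0) (b := t)
    (C := ‖discreteLaplacian‖ * ‖u‖)
    (fun r _ => (hasDerivAt_heat_apply r u).hasDerivWithinAt) (fun r hr => by
      refine (ContinuousLinearMap.le_opNorm _ _).trans ?_
      gcongr
      exact ContinuousLinearMap.le_of_opNorm_le_of_le _ (norm_heat_le hr.1) le_rfl |>.trans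
        (one_mul _).le) t (right_mem_Icc.2 ht)
  simpa [heat_zero] using h

/-- The coefficients `t^n / n!` of the exponential series, extended by zero to `ℤ`. -/
def expCoeff (t : ℝ) (n : ℤ) : ℝ := if 0 ≤ n then t ^ n.toNat / n.toNat.factorial else 0

theorem expCoeff_natCast (t : ℝ) (n : ℕ) : expCoeff t n = t ^ n / n.factorial := by
  simp [expCoeff]

theorem expCoeff_of_neg (t : ℝ) {n : ℤ} (hn : n < 0) : expCoeff t n = 0 := by
  simp [expCoeff, hn]

theorem expCoeff_nonneg {t : ℝ} (ht : 0 ≤ t) (n : ℤ) : 0 ≤ expCoeff t n := by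
  rw [expCoeff]; split_ifs <;> positivity

theorem mul_expCoeff (t : ℝ) (n : ℤ) : n * expCoeff t n = t * expCoeff t (n - 1) := by
  rcases lt_or_ge n 0 with h | h
  · rw [expCoeff_of_neg t h, expCoeff_of_neg t (by lia)]; simp
  · obtain ⟨k, rfl⟩ := Int.eq_ofNat_of_zero_le h
    cases k with
    | zero => rw [expCoeff_of_neg t (n := ((0 : ℕ) : ℤ) - 1) (by norm_num)]; simp
    | succ k =>
      have : ((k + 1 : ℕ) : ℤ) - 1 = k := by push_cast; ring
      rw [this, expCoeff_natCast, expCoeff_natCast, Nat.factorial_succ]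
      push_cast
      field_simp
      ring

theorem hasSum_int_iff_hasSum_nat {f : ℤ → ℝ} {a : ℝ} (hf : ∀ n < 0, f n = 0) :
    HasSum (fun n : ℕ => f n) a ↔ HasSum f a := by
  refine Function.Injective.hasSum_iff (g := fun n : ℕ => (n : ℤ)) Nat.cast_injective
    fun n hn => hf n ?_
  by_contra h
  exact hn ⟨n.toNat, by simp; lia⟩

theorem hasSum_expCoeff (t : ℝ) : HasSum (expCoeff t) (Real.exp t) := by
  rw [← hasSum_int_iff_hasSum_nat fun n => expCoeff_of_neg t]
  simp only [expCoeff_natCast]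
  rw [Real.exp_eq_exp_ℝ]
  exact NormedSpace.expSeries_div_hasSum_exp t

theorem hasSum_exp_shift (t : ℝ) (k : ℤ) (u : l2) (x : ℤ) :
    HasSum (fun n : ℕ => expCoeff t n * u (x + n * k)) (NormedSpace.exp (t • shift k) u x) := by
  have h1 := NormedSpace.exp_series_hasSum_exp' (𝕂 := ℝ) (t • shift k)
  have h2 := (h1.mapL (ContinuousLinearMap.apply ℝ l2 u)).mapL (innerSL ℝ (unit x))
  simp only [innerSL_apply_apply, unit_inner, ContinuousLinearMap.apply_apply] at h2
  refine h2.congr_fun fun n => ?_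
  rw [smul_pow]
  simp only [smul_apply, lp.coeFn_smul, Pi.smul_apply, smul_eq_mul,
    shift_pow_apply, expCoeff_natCast]
  ring

/-- The heat kernel `e^{-2t} I_{|m|}(2t)` of the discrete Laplacian. -/
def heatKernel (t : ℝ) (m : ℤ) : ℝ := heat t (unit 0) m

theorem hasSum_heat_unit (t : ℝ) (x y : ℤ) :
    HasSum (fun j => Real.exp (-(2 * t)) * (expCoeff t j * expCoeff t (y - x + j)))
      (heat t (unit x) y) := by
  have h1 : ∀ z, NormedSpace.exp (t • shift (-1)) (unit x) z = expCoeff t (z - x) := fun z => by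
    rw [← (hasSum_exp_shift t (-1) (unit x) z).tsum_eq]
    have h := (hasSum_int_iff_hasSum_nat
      (f := fun n : ℤ => expCoeff t n * unit x (z + n * -1)) (a := expCoeff t (z - x))
      fun n hn => by rw [expCoeff_of_neg t hn, zero_mul]).2 (by
        convert hasSum_ite_eq (z - x) (expCoeff t (z - x)) using 2 with n
        rw [unit_apply]
        by_cases hn : n = z - x
        · subst hn; simp
        · rw [if_neg hn, if_neg (by lia), mul_zero])
    exact h.tsum_eq
  have h2 := hasSum_exp_shift t 1 (NormedSpace.exp (t • shift (-1)) (unit x)) y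
  simp only [h1] at h2
  have h3 := (hasSum_int_iff_hasSum_nat
    (f := fun n : ℤ => expCoeff t n * expCoeff t (y + n * 1 - x))
      fun n hn => by rw [expCoeff_of_neg t hn, zero_mul]).1 h2
  rw [heat_eq]
  simp only [smul_apply, lp.coeFn_smul, Pi.smul_apply, smul_eq_mul,
    mul_apply_eq_comp]
  refine (h3.mul_left (Real.exp (-(2 * t)))).congr_fun fun j => ?_
  rw [mul_one, sub_add_eq_add_sub]

theorem hasSum_heatKernel (t : ℝ) (m : ℤ) :
    HasSum (fun j => Real.exp (-(2 * t)) * (expCoeff t j * expCoeff t (m + j)))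
      (heatKernel t m) := by
  simpa [heatKernel] using hasSum_heat_unit t 0 m

theorem heat_unit_apply (t : ℝ) (x y : ℤ) : heat t (unit x) y = heatKernel t (y - x) :=
  (hasSum_heat_unit t x y).unique (hasSum_heatKernel t (y - x))

theorem heatKernel_nonneg {t : ℝ} (ht : 0 ≤ t) (m : ℤ) : 0 ≤ heatKernel t m :=
  (hasSum_heatKernel t m).nonneg fun _ => mul_nonneg (Real.exp_pos _).le
    (mul_nonneg (expCoeff_nonneg ht _) (expCoeff_nonneg ht _))

theorem heatKernel_neg (t : ℝ) (m : ℤ) : heatKernel t (-m) = heatKernel t m := by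
  refine (hasSum_heatKernel t (-m)).unique ?_
  rw [← (Equiv.addRight m).hasSum_iff]
  convert hasSum_heatKernel t m using 2 with j
  simp only [Function.comp_apply, Equiv.coe_addRight]
  rw [neg_add_cancel_comm_assoc, add_comm j m]
  ring

/-- The Bessel recurrence: write `m = (m + j) - j` and apply `n c_n = t c_{n-1}` to each of the two
exponential coefficients. -/
theorem mul_heatKernel (t : ℝ) (m : ℤ) :
    m * heatKernel t m = t * (heatKernel t (m - 1) - heatKernel t (m + 1)) := by
  have h1 := (hasSum_heatKernel t (m - 1)).mul_left t
  have h2 := ((Equiv.subRight (1 : ℤ)).hasSum_iff.2 (hasSum_heatKernel t (m + 1))).mul_left t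
  have h3 := h1.sub h2
  rw [← mul_sub] at h3
  refine ((hasSum_heatKernel t m).mul_left (m : ℝ)).unique (h3.congr_fun fun j => ?_)
  have e1 := mul_expCoeff t (m + j)
  have e2 := mul_expCoeff t j
  have e3 : m - 1 + j = m + j - 1 := by ring
  have e4 : m + 1 + (j - 1) = m + j := by ring
  simp only [Function.comp_apply, Equiv.subRight_apply, e3, e4]
  push_cast at e1
  linear_combination Real.exp (-(2 * t)) * expCoeff t j * e1
    - Real.exp (-(2 * t)) * expCoeff t (m + j) * e2

theorem hasDerivAt_heatKernel (t : ℝ) (m : ℤ) : HasDerivAt (fun t => heatKernel t m)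
    (heatKernel t (m + 1) - 2 * heatKernel t m + heatKernel t (m - 1)) t := by
  have h := (innerSL ℝ (unit m)).hasFDerivAt.comp_hasDerivAt t (hasDerivAt_heat_apply t (unit 0))
  simp only [innerSL_apply_apply, unit_inner, discreteLaplacian_apply] at h
  refine h.congr_of_eventuallyEq (Eventually.of_forall fun r => ?_)
  simp [heatKernel, unit_inner]

theorem continuous_heatKernel (m : ℤ) : Continuous fun t => heatKernel t m :=
  continuous_iff_continuousAt.2 fun t => (hasDerivAt_heatKernel t m).continuousAt

theorem tsum_heatKernel_le {t : ℝ} (ht : 0 ≤ t) :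
    ∑' m, ENNReal.ofReal (heatKernel t m) ≤ 1 := by
  have hw := fun n => expCoeff_nonneg ht n
  have hexp : ∑' n, ENNReal.ofReal (expCoeff t n) = ENNReal.ofReal (Real.exp t) := by
    rw [← ENNReal.ofReal_tsum_of_nonneg hw (hasSum_expCoeff t).summable,
      (hasSum_expCoeff t).tsum_eq]
  have e : ∀ m, ENNReal.ofReal (heatKernel t m) = ∑' j, ENNReal.ofReal (Real.exp (-(2 * t))) *
      (ENNReal.ofReal (expCoeff t j) * ENNReal.ofReal (expCoeff t (m + j))) := fun m => by
    rw [← (hasSum_heatKernel t m).tsum_eq, ENNReal.ofReal_tsum_of_nonneg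
      (fun j => mul_nonneg (Real.exp_pos _).le (mul_nonneg (hw _) (hw _)))
      (hasSum_heatKernel t m).summable]
    exact tsum_congr fun j => by
      rw [ENNReal.ofReal_mul (Real.exp_pos _).le, ENNReal.ofReal_mul (hw _)]
  simp only [e]
  rw [ENNReal.tsum_comm]
  have e2 : ∀ j : ℤ, ∑' m, ENNReal.ofReal (expCoeff t (m + j)) = ENNReal.ofReal (Real.exp t) :=
    fun j => by
      rw [← hexp]
      exact (Equiv.addRight j).tsum_eq fun n => ENNReal.ofReal (expCoeff t n)
  simp only [ENNReal.tsum_mul_left, e2, ENNReal.tsum_mul_right, hexp]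
  rw [← ENNReal.ofReal_mul (Real.exp_pos _).le, ← ENNReal.ofReal_mul (Real.exp_pos _).le,
    ← Real.exp_add, ← Real.exp_add]
  ring_nf
  simp

theorem heatKernel_le_one {t : ℝ} (ht : 0 ≤ t) (m : ℤ) : heatKernel t m ≤ 1 := by
  have := (ENNReal.le_tsum m).trans (tsum_heatKernel_le ht)
  simpa using this

theorem mul_exp_le_heatKernel_one {t : ℝ} (ht : 0 ≤ t) :
    t * Real.exp (-(2 * t)) ≤ heatKernel t 1 := by
  have h := le_hasSum (hasSum_heatKernel t 1) 0 fun j _ => mul_nonneg (Real.exp_pos _).le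
    (mul_nonneg (expCoeff_nonneg ht _) (expCoeff_nonneg ht _))
  have e0 : expCoeff t 0 = 1 := by simp [expCoeff]
  have e1 : expCoeff t 1 = t := by simp [expCoeff]
  rw [add_zero, e0, e1] at h
  linarith

theorem norm_unit (x : ℤ) : ‖unit x‖ = 1 := by
  rw [unit, lp.norm_single (by norm_num)]; simp

theorem abs_heatKernel_sub_le {t : ℝ} (ht : 0 ≤ t) (m : ℤ) :
    |heatKernel t m - if m = 0 then 1 else 0| ≤ ‖discreteLaplacian‖ * t := by
  have h := (abs_apply_le_norm (heat t (unit 0) - unit 0) m).trans (norm_heat_sub_le ht (unit 0))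
  rw [norm_unit, mul_one, lp.coeFn_sub, Pi.sub_apply, unit_apply] at h
  exact h

/-! ### The jump kernel of the fractional Laplacian -/

/-- The linear bound gives `t^(-s)` near zero, the uniform bound `t^(-1-s)` at infinity. -/
theorem integrableOn_one_div_rpow_smul {E : Type*} [NormedAddCommGroup E] [NormedSpace ℝ E]
    {s : ℝ} (hs0 : 0 < s) (hs1 : s < 1) {F : ℝ → E} (hF : Continuous F) {C M : ℝ}
    (hC : ∀ t, 0 < t → ‖F t‖ ≤ C * t) (hM : ∀ t, 0 < t → ‖F t‖ ≤ M) :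
    IntegrableOn (fun t => (1 / t ^ (1 + s)) • F t) (Ioi 0) := by
  have hmeas : ∀ {S : Set ℝ}, MeasurableSet S →
      AEStronglyMeasurable (fun t => (1 / t ^ (1 + s)) • F t) (volume.restrict S) := fun _ =>
    ((by fun_prop : Measurable fun t : ℝ => 1 / t ^ (1 + s)).aestronglyMeasurable).smul
      hF.aestronglyMeasurable
  rw [← Ioc_union_Ioi_eq_Ioi zero_le_one, integrableOn_union]
  constructor
  · have hg : IntegrableOn (fun t : ℝ => C * t ^ (-s)) (Ioc 0 1) := by
      refine Integrable.const_mul ?_ C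
      exact (intervalIntegrable_iff_integrableOn_Ioc_of_le zero_le_one).1
        (intervalIntegral.intervalIntegrable_rpow' (by linarith))
    refine Integrable.mono' hg (hmeas measurableSet_Ioc) ?_
    refine (ae_restrict_mem measurableSet_Ioc).mono fun t ht => ?_
    have h1 : 0 ≤ 1 / t ^ (1 + s) := by have := ht.1; positivity
    rw [norm_smul, Real.norm_of_nonneg h1]
    calc 1 / t ^ (1 + s) * ‖F t‖ ≤ 1 / t ^ (1 + s) * (C * t) := by gcongr; exact hC t ht.1
      _ = C * t ^ (-s) := by
        rw [Real.rpow_add ht.1, Real.rpow_one, Real.rpow_neg ht.1.le]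
        have := ht.1.ne'
        have := (Real.rpow_pos_of_pos ht.1 s).ne'
        field_simp
  · have hg : IntegrableOn (fun t : ℝ => M * t ^ (-(1 + s))) (Ioi 1) :=
      Integrable.const_mul (integrableOn_Ioi_rpow_of_lt (by linarith) zero_lt_one) M
    refine Integrable.mono' hg (hmeas measurableSet_Ioi) ?_
    refine (ae_restrict_mem measurableSet_Ioi).mono fun t ht => ?_
    have h0 : 0 < t := zero_lt_one.trans ht
    have h1 : 0 ≤ 1 / t ^ (1 + s) := by positivity
    rw [norm_smul, Real.norm_of_nonneg h1, Real.rpow_neg h0.le, one_div, mul_comm]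
    gcongr
    exact hM t h0

theorem continuous_heat_apply (u : l2) : Continuous fun t => heat t u :=
  continuous_iff_continuousAt.2 fun t => (hasDerivAt_heat_apply t u).continuousAt

theorem integrableOn_heat_sub {s : ℝ} (hs0 : 0 < s) (hs1 : s < 1) (u : l2) :
    IntegrableOn (fun t : ℝ => (1 / t ^ (1 + s)) • (heat t u - u)) (Ioi 0) := by
  refine integrableOn_one_div_rpow_smul hs0 hs1 ((continuous_heat_apply u).sub continuous_const)
    (C := ‖discreteLaplacian‖ * ‖u‖) (M := ‖u‖ + ‖u‖)
    (fun t ht => norm_heat_sub_le ht.le u) fun t ht => ?_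
  refine (norm_sub_le _ _).trans (add_le_add_left ?_ _)
  simpa using ContinuousLinearMap.le_of_opNorm_le _ (norm_heat_le ht.le) u

theorem integrableOn_heatKernel_sub {s : ℝ} (hs0 : 0 < s) (hs1 : s < 1) (m : ℤ) :
    IntegrableOn (fun t : ℝ => (1 / t ^ (1 + s)) * (heatKernel t m - if m = 0 then 1 else 0))
      (Ioi 0) := by
  refine integrableOn_one_div_rpow_smul hs0 hs1 ((continuous_heatKernel m).sub continuous_const)
    (fun t ht => abs_heatKernel_sub_le ht.le m) (M := 1) fun t ht => ?_
  have h0 := heatKernel_nonneg ht.le m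
  have h1 := heatKernel_le_one ht.le m
  rw [Real.norm_eq_abs, abs_le]
  split_ifs <;> constructor <;> linarith

theorem integrableOn_heatKernel {s : ℝ} (hs0 : 0 < s) (hs1 : s < 1) {m : ℤ} (hm : m ≠ 0) :
    IntegrableOn (fun t : ℝ => (1 / t ^ (1 + s)) * heatKernel t m) (Ioi 0) := by
  simpa [hm] using integrableOn_heatKernel_sub hs0 hs1 m

/-- The jump rates of `(-Δ)^s`, as integrals of the heat kernel. -/
def jump (s : ℝ) (m : ℤ) : ℝ :=
  if m = 0 then 0 else
    (1 / |Real.Gamma (-s)|) * ∫ t in Ioi (0 : ℝ), (1 / t ^ (1 + s)) * heatKernel t m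

/-- The diagonal coefficient of `(-Δ)^s`. -/
def holding (s : ℝ) : ℝ :=
  (1 / |Real.Gamma (-s)|) * ∫ t in Ioi (0 : ℝ), (1 / t ^ (1 + s)) * (1 - heatKernel t 0)

theorem Gamma_neg_lt_zero {s : ℝ} (hs0 : 0 < s) (hs1 : s < 1) : Real.Gamma (-s) < 0 := by
  have h := Real.Gamma_add_one (s := -s) (by linarith)
  have h1 : 0 < Real.Gamma (-s + 1) := Real.Gamma_pos_of_pos (by linarith)
  nlinarith

theorem fracLaplacian_unit_apply {s : ℝ} (hs0 : 0 < s) (hs1 : s < 1) (x y : ℤ) :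
    fracLaplacian s (unit x) y = if y = x then holding s else - jump s (y - x) := by
  have h1 : fracLaplacian s (unit x) y = (1 / Real.Gamma (-s)) *
      ∫ t in Ioi (0 : ℝ), (1 / t ^ (1 + s)) *
        (heatKernel t (y - x) - if y - x = 0 then 1 else 0) := by
    rw [fracLaplacian, lp.coeFn_smul, Pi.smul_apply, smul_eq_mul, ← unit_inner]
    congr 1
    have h := ContinuousLinearMap.integral_comp_comm (innerSL ℝ (unit y))
      (integrableOn_heat_sub hs0 hs1 (unit x))
    rw [innerSL_apply_apply] at h
    rw [← h]
    refine integral_congr_ae (Eventually.of_forall fun t => ?_)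
    simp only [innerSL_apply_apply, unit_inner, lp.coeFn_smul, lp.coeFn_sub, Pi.smul_apply,
      Pi.sub_apply, smul_eq_mul, heat_unit_apply, unit_apply, sub_eq_zero]
  have hG : 1 / Real.Gamma (-s) = -(1 / |Real.Gamma (-s)|) := by
    rw [abs_of_neg (Gamma_neg_lt_zero hs0 hs1), div_neg, neg_neg]
  rw [h1, hG]
  split_ifs with h h' h'
  · rw [h', sub_self, holding, neg_mul, ← mul_neg, ← integral_neg]
    congr 2
    ext t
    ring
  · exact absurd (sub_eq_zero.1 h) h'
  · exact absurd (sub_eq_zero.2 h') h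
  · simp only [sub_zero, jump, if_neg h, neg_mul]

theorem jump_neg (s : ℝ) (m : ℤ) : jump s (-m) = jump s m := by
  simp only [jump, neg_eq_zero, heatKernel_neg]

theorem jump_nonneg (s : ℝ) (m : ℤ) : 0 ≤ jump s m := by
  rw [jump]
  split_ifs
  · exact le_rfl
  · refine mul_nonneg (by positivity) (setIntegral_nonneg measurableSet_Ioi fun t ht => ?_)
    have := heatKernel_nonneg (le_of_lt ht) m
    have : (0 : ℝ) < t := ht
    positivity

theorem ofReal_jump {s : ℝ} (hs0 : 0 < s) (hs1 : s < 1) (m : ℤ) :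
    ENNReal.ofReal (jump s m) = ENNReal.ofReal (1 / |Real.Gamma (-s)|) *
      ∫⁻ t in Ioi (0 : ℝ), ENNReal.ofReal (1 / t ^ (1 + s)) *
        (if m = 0 then 0 else ENNReal.ofReal (heatKernel t m)) := by
  have hw : ∀ t ∈ Ioi (0 : ℝ), 0 ≤ 1 / t ^ (1 + s) := fun t ht => by
    have : (0 : ℝ) < t := ht
    positivity
  rw [jump]
  split_ifs with hm
  · simp
  · rw [ENNReal.ofReal_mul (by positivity), ofReal_integral_eq_lintegral_ofReal
      (integrableOn_heatKernel hs0 hs1 hm)]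
    · congr 1
      refine setLIntegral_congr_fun measurableSet_Ioi fun t ht => ?_
      exact ENNReal.ofReal_mul (hw t ht)
    · refine (ae_restrict_mem measurableSet_Ioi).mono fun t ht => ?_
      exact mul_nonneg (hw t ht) (heatKernel_nonneg (le_of_lt ht) m)

theorem ofReal_holding {s : ℝ} (hs0 : 0 < s) (hs1 : s < 1) :
    ENNReal.ofReal (holding s) = ENNReal.ofReal (1 / |Real.Gamma (-s)|) *
      ∫⁻ t in Ioi (0 : ℝ), ENNReal.ofReal (1 / t ^ (1 + s)) *
        ENNReal.ofReal (1 - heatKernel t 0) := by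
  have hw : ∀ t ∈ Ioi (0 : ℝ), 0 ≤ 1 / t ^ (1 + s) := fun t ht => by
    have : (0 : ℝ) < t := ht
    positivity
  rw [holding, ENNReal.ofReal_mul (by positivity), ofReal_integral_eq_lintegral_ofReal]
  · congr 1
    refine setLIntegral_congr_fun measurableSet_Ioi fun t ht => ?_
    exact ENNReal.ofReal_mul (hw t ht)
  · refine (integrableOn_heatKernel_sub hs0 hs1 0).neg.congr
      (Eventually.of_forall fun t => ?_)
    simp only [Pi.neg_apply, if_true]
    ring
  · refine (ae_restrict_mem measurableSet_Ioi).mono fun t ht => ?_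
    exact mul_nonneg (hw t ht) (sub_nonneg.2 (heatKernel_le_one (le_of_lt ht) 0))

theorem tsum_ite_le_one_sub {g : ℤ → ℝ≥0∞} (hg : ∑' m, g m ≤ 1) :
    ∑' m : ℤ, (if m = 0 then 0 else g m) ≤ 1 - g 0 := by
  have h0 : g 0 ≠ ⊤ := ne_top_of_le_ne_top ENNReal.one_ne_top ((ENNReal.le_tsum 0).trans hg)
  refine ENNReal.le_sub_of_add_le_left h0 (le_of_eq_of_le ?_ hg)
  exact (Summable.tsum_eq_add_tsum_ite' (f := g) 0 ENNReal.summable).symm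

theorem tsum_heatKernel_ne_zero_le {t : ℝ} (ht : 0 ≤ t) :
    ∑' m : ℤ, (if m = 0 then 0 else ENNReal.ofReal (heatKernel t m)) ≤
      ENNReal.ofReal (1 - heatKernel t 0) := by
  have h := tsum_ite_le_one_sub (tsum_heatKernel_le ht)
  rwa [← ENNReal.ofReal_one, ← ENNReal.ofReal_sub _ (heatKernel_nonneg ht 0)] at h

/-- Tonelli, and the fact that the heat kernel has mass at most one. A possible defect would act as
extra killing, so the inequality suffices. -/
theorem tsum_jump_le {s : ℝ} (hs0 : 0 < s) (hs1 : s < 1) :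
    ∑' m, ENNReal.ofReal (jump s m) ≤ ENNReal.ofReal (holding s) := by
  have hmeas : ∀ m : ℤ, AEMeasurable (fun t : ℝ => ENNReal.ofReal (1 / t ^ (1 + s)) *
      (if m = 0 then 0 else ENNReal.ofReal (heatKernel t m))) (volume.restrict (Ioi 0)) :=
    fun m => by
      have := (continuous_heatKernel m).measurable
      split_ifs <;> fun_prop
  simp only [ofReal_jump hs0 hs1, ofReal_holding hs0 hs1]
  rw [ENNReal.tsum_mul_left, ← lintegral_tsum hmeas]
  refine mul_le_mul_right (setLIntegral_mono' measurableSet_Ioi fun t ht => ?_) _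
  rw [ENNReal.tsum_mul_left]
  exact mul_le_mul_right (tsum_heatKernel_ne_zero_le (le_of_lt ht)) _

/-! ### Comparison of `K_s` with the jump rates -/

/-- The heat kernel integrals satisfy the two-term recursion of `kernel`. -/
theorem integral_heatKernel_succ {s : ℝ} (hs0 : 0 < s) (hs1 : s < 1) {m : ℤ} (hm : 0 < m) :
    (m - s) * ∫ t in Ioi (0 : ℝ), (1 / t ^ (1 + s)) * heatKernel t m =
      (m + 1 + s) * ∫ t in Ioi (0 : ℝ), (1 / t ^ (1 + s)) * heatKernel t (m + 1) := by
  have hm1 : m + 1 ≠ 0 := by lia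
  have i1 := (integrableOn_heatKernel hs0 hs1 hm.ne').const_mul (m - s)
  have i2 := (integrableOn_heatKernel hs0 hs1 hm1).const_mul (m + 1 + s)
  rw [← sub_eq_zero, ← integral_const_mul, ← integral_const_mul, ← integral_sub i1 i2]
  -- By the Bessel recurrence, `t^(-s) H(t)` is a primitive of the difference of the two integrands.
  -- It vanishes at zero, where `H = O(t)` and `s < 1`, and at infinity, where `H ≤ 2`.
  set H : ℝ → ℝ := fun t => heatKernel t m + heatKernel t (m + 1) with hH
  have hH0 : ∀ t, 0 ≤ t → 0 ≤ H t := fun t ht =>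
    add_nonneg (heatKernel_nonneg ht _) (heatKernel_nonneg ht _)
  have hH2 : ∀ t, 0 ≤ t → H t ≤ 2 := fun t ht => by
    have := heatKernel_le_one ht m
    have := heatKernel_le_one ht (m + 1)
    simp only [hH]; linarith
  have hHC : ∀ t, 0 ≤ t → H t ≤ 2 * ‖discreteLaplacian‖ * t := fun t ht => by
    have h1 := (abs_le.1 (abs_heatKernel_sub_le ht m)).2
    have h2 := (abs_le.1 (abs_heatKernel_sub_le ht (m + 1))).2
    rw [if_neg hm.ne'] at h1
    rw [if_neg hm1] at h2
    simp only [hH]; linarith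
  have hlim0 : ContinuousWithinAt (fun t : ℝ => t ^ (-s) * H t) (Ici 0) 0 := by
    have hz : (0 : ℝ) ^ (-s) * H 0 = 0 := by rw [Real.zero_rpow (by linarith), zero_mul]
    rw [ContinuousWithinAt, hz]
    have hb : Tendsto (fun t : ℝ => 2 * ‖discreteLaplacian‖ * t ^ (1 - s)) (𝓝[≥] 0) (𝓝 0) := by
      have h : Continuous fun t : ℝ => 2 * ‖discreteLaplacian‖ * t ^ (1 - s) :=
        continuous_const.mul (Real.continuous_rpow_const (by linarith))
      have := h.tendsto 0
      rw [Real.zero_rpow (by linarith), mul_zero] at this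
      exact this.mono_left nhdsWithin_le_nhds
    refine tendsto_of_tendsto_of_tendsto_of_le_of_le' tendsto_const_nhds hb ?_ ?_
    · filter_upwards [self_mem_nhdsWithin] with t ht
      exact mul_nonneg (Real.rpow_nonneg ht _) (hH0 t ht)
    · filter_upwards [self_mem_nhdsWithin] with t ht
      rcases (show (0 : ℝ) ≤ t from ht).eq_or_lt with rfl | ht0
      · rw [hz, Real.zero_rpow (by linarith), mul_zero]
      · calc t ^ (-s) * H t ≤ t ^ (-s) * (2 * ‖discreteLaplacian‖ * t) := by
              gcongr; exact hHC t ht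
          _ = _ := by rw [sub_eq_neg_add, Real.rpow_add_one ht0.ne']; ring
  have hlim1 : Tendsto (fun t : ℝ => t ^ (-s) * H t) atTop (𝓝 0) := by
    have hb := (tendsto_rpow_neg_atTop hs0).mul_const 2
    rw [zero_mul] at hb
    refine tendsto_of_tendsto_of_tendsto_of_le_of_le' tendsto_const_nhds hb ?_ ?_
    · filter_upwards [eventually_ge_atTop 0] with t ht
      exact mul_nonneg (Real.rpow_nonneg ht _) (hH0 t ht)
    · filter_upwards [eventually_ge_atTop 0] with t ht
      gcongr
      exact hH2 t ht
  have hI := integral_Ioi_of_hasDerivAt_of_tendsto hlim0 (fun t (ht : 0 < t) => ?_)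
    (Integrable.sub i1 i2) hlim1
  · simpa [Real.zero_rpow (by linarith : -s ≠ 0)] using hI
  · have hd := (Real.hasDerivAt_rpow_const (x := t) (p := -s) (Or.inl ht.ne')).mul
      ((hasDerivAt_heatKernel t m).add (hasDerivAt_heatKernel t (m + 1)))
    refine hd.congr_deriv ?_
    have r1 := mul_heatKernel t m
    have r2 := mul_heatKernel t (m + 1)
    push_cast at r2
    have p1 : t ^ (-s) = t * t ^ (-s - 1) := by
      rw [Real.rpow_sub_one ht.ne']; field_simp
    have p2 : 1 / t ^ (1 + s) = t ^ (-s - 1) := by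
      rw [one_div, ← Real.rpow_neg ht.le]; ring_nf
    simp only [Pi.add_apply, Pi.sub_apply, p1, p2, add_sub_cancel_right] at r1 r2 ⊢
    linear_combination (-(t ^ (-s - 1))) * r1 + (t ^ (-s - 1)) * r2

theorem le_integral_heatKernel_one {s : ℝ} (hs0 : 0 < s) (hs1 : s < 1) :
    (1 / 2) ^ (1 - s) * Real.Gamma (1 - s) ≤
      ∫ t in Ioi (0 : ℝ), (1 / t ^ (1 + s)) * heatKernel t 1 := by
  have hint := integrableOn_heatKernel hs0 hs1 (one_ne_zero : (1 : ℤ) ≠ 0)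
  rw [← Real.integral_rpow_mul_exp_neg_mul_Ioi (by linarith) two_pos]
  have hle : ∀ t ∈ Ioi (0 : ℝ), t ^ (1 - s - 1) * Real.exp (-(2 * t)) ≤
      (1 / t ^ (1 + s)) * heatKernel t 1 := fun t (ht : 0 < t) => by
    have e : t ^ (1 - s - 1) = 1 / t ^ (1 + s) * t := by
      rw [one_div, ← Real.rpow_neg ht.le, ← Real.rpow_add_one ht.ne']; ring_nf
    rw [e, mul_assoc]
    gcongr
    exact mul_exp_le_heatKernel_one ht.le
  refine setIntegral_mono_on ?_ hint measurableSet_Ioi hle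
  refine Integrable.mono' hint (by fun_prop : Measurable fun t : ℝ =>
    t ^ (1 - s - 1) * Real.exp (-(2 * t))).aestronglyMeasurable
    ((ae_restrict_mem measurableSet_Ioi).mono fun t ht => ?_)
  rw [Real.norm_of_nonneg (mul_nonneg (Real.rpow_nonneg (le_of_lt ht) _) (Real.exp_pos _).le)]
  exact hle t ht

/-- Convexity between `Γ(1/2) = √π` and `Γ(3/2) = √π / 2` bounds the left side by `√π`, and `Γ ≥ 1`
on `[2, ∞)`. -/
theorem Gamma_half_add_le {s : ℝ} (hs0 : 0 < s) (hs1 : s < 1) :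
    Real.Gamma (1 / 2 + s) ≤ √Real.pi * Real.Gamma (2 + s) := by
  have h1 : Real.Gamma (1 / 2 + s) ≤ √Real.pi := by
    have hc := Real.convexOn_Gamma.2 (show (1 / 2 : ℝ) ∈ Ioi 0 by norm_num)
      (show (1 / 2 + 1 : ℝ) ∈ Ioi 0 by norm_num) (show 0 ≤ 1 - s by linarith) hs0.le (by ring)
    rw [Real.Gamma_add_one (by norm_num), Real.Gamma_one_half_eq] at hc
    have e : (1 - s) • (1 / 2 : ℝ) + s • (1 / 2 + 1 : ℝ) = 1 / 2 + s := by
      simp only [smul_eq_mul]; ring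
    rw [e] at hc
    refine hc.trans ?_
    simp only [smul_eq_mul]
    nlinarith [Real.sqrt_nonneg Real.pi]
  have h2 : 1 ≤ Real.Gamma (2 + s) := by
    rw [← Real.Gamma_two]
    exact Real.Gamma_strictMonoOn_Ici.monotoneOn (by simp) (by simp; linarith) (by linarith)
  nlinarith [Real.sqrt_nonneg Real.pi]

theorem kernel_one_le {s : ℝ} (hs0 : 0 < s) (hs1 : s < 1) : kernel s 1 ≤ 4 * jump s 1 := by
  have hG : 0 < |Real.Gamma (-s)| := abs_pos.2 (Gamma_neg_lt_zero hs0 hs1).ne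
  have hG1 : 0 < Real.Gamma (1 - s) := Real.Gamma_pos_of_pos (by linarith)
  have hG2 : 0 < Real.Gamma (2 + s) := Real.Gamma_pos_of_pos (by linarith)
  have hG3 : 0 < Real.Gamma (1 / 2 + s) := Real.Gamma_pos_of_pos (by linarith)
  have hpi : 0 < √Real.pi := Real.sqrt_pos.2 Real.pi_pos
  have h4 : (4 : ℝ) ^ s ≤ 4 * (1 / 2) ^ (1 - s) := by
    have e1 : (4 : ℝ) ^ s = 2 ^ s * 2 ^ s := by
      rw [← Real.mul_rpow (by norm_num) (by norm_num)]; norm_num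
    have e2 : (1 / 2 : ℝ) ^ (1 - s) = 2 ^ s / 2 := by
      rw [one_div, Real.inv_rpow (by norm_num), Real.rpow_sub (by norm_num), Real.rpow_one, inv_div]
    have e3 : (2 : ℝ) ^ s ≤ 2 := by
      simpa using Real.rpow_le_rpow_of_exponent_le (by norm_num : (1 : ℝ) ≤ 2) hs1.le
    have e4 : (0 : ℝ) < 2 ^ s := by positivity
    rw [e1, e2]
    nlinarith
  have hint := le_integral_heatKernel_one hs0 hs1
  have hfrac : Real.Gamma (1 / 2 + s) / (√Real.pi * Real.Gamma (2 + s)) ≤ 1 :=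
    (div_le_one (by positivity)).2 (Gamma_half_add_le hs0 hs1)
  have e2s : (1 : ℝ) + 1 + s = 2 + s := by ring
  rw [kernel, jump, if_neg one_ne_zero, if_neg one_ne_zero, Int.cast_one, abs_one, e2s]
  calc _ = (1 / |Real.Gamma (-s)|) * (4 ^ s *
        (Real.Gamma (1 / 2 + s) / (√Real.pi * Real.Gamma (2 + s))) * Real.Gamma (1 - s)) := by
        field_simp
    _ ≤ (1 / |Real.Gamma (-s)|) * ((4 * (1 / 2) ^ (1 - s)) * 1 * Real.Gamma (1 - s)) := by
        gcongr
    _ = 4 * ((1 / |Real.Gamma (-s)|) * ((1 / 2) ^ (1 - s) * Real.Gamma (1 - s))) := by ring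
    _ ≤ _ := by gcongr

theorem kernel_neg (s : ℝ) (m : ℤ) : kernel s (-m) = kernel s m := by
  simp only [kernel, neg_eq_zero, Int.cast_neg, abs_neg]

theorem kernel_succ {s : ℝ} (hs0 : 0 < s) (hs1 : s < 1) {m : ℤ} (hm : 0 < m) :
    kernel s (m + 1) = (m - s) / (m + 1 + s) * kernel s m := by
  have hm1 : m + 1 ≠ 0 := by lia
  have hmR : (1 : ℝ) ≤ m := by exact_mod_cast hm
  rw [kernel, kernel, if_neg hm.ne', if_neg hm1]
  push_cast
  rw [abs_of_nonneg (by linarith : (0 : ℝ) ≤ (m : ℝ) + 1), abs_of_nonneg (by linarith : (0 : ℝ) ≤ m)]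
  have e1 : (m : ℝ) + 1 - s = (m - s) + 1 := by ring
  have e2 : (m : ℝ) + 1 + 1 + s = (m + 1 + s) + 1 := by ring
  rw [e1, e2, Real.Gamma_add_one (by linarith), Real.Gamma_add_one (by linarith),
    mul_div_mul_comm ((m : ℝ) - s)]
  ring

theorem kernel_le_jump {s : ℝ} (hs0 : 0 < s) (hs1 : s < 1) (m : ℤ) :
    kernel s m ≤ 4 * jump s m := by
  have hpos : ∀ n : ℕ, kernel s (n + 1) ≤ 4 * jump s (n + 1) := fun n => by
    induction n with
    | zero => simpa using kernel_one_le hs0 hs1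
    | succ n ih =>
      have hn : (0 : ℤ) < n + 1 := by positivity
      have hnR : (0 : ℝ) ≤ n := n.cast_nonneg
      have hr := integral_heatKernel_succ hs0 hs1 hn
      have hj : jump s ((n + 1 : ℤ) + 1) =
          (((n + 1 : ℤ) : ℝ) - s) / (((n + 1 : ℤ) : ℝ) + 1 + s) * jump s (n + 1) := by
        rw [jump, jump, if_neg hn.ne', if_neg (by lia)]
        have h0 : ((n + 1 : ℤ) : ℝ) + 1 + s ≠ 0 := by push_cast; linarith
        rw [mul_left_comm, div_mul_eq_mul_div (((n + 1 : ℤ) : ℝ) - s), hr, mul_div_cancel_left₀ _ h0]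
      push_cast
      rw [kernel_succ hs0 hs1 hn, hj]
      have h0 : 0 ≤ (((n + 1 : ℤ) : ℝ) - s) / (((n + 1 : ℤ) : ℝ) + 1 + s) := by
        push_cast
        exact div_nonneg (by linarith) (by linarith)
      calc _ ≤ (((n + 1 : ℤ) : ℝ) - s) / (((n + 1 : ℤ) : ℝ) + 1 + s) * (4 * jump s (n + 1)) := by
            gcongr
        _ = _ := by ring
  have hpos' : ∀ m : ℤ, 0 < m → kernel s m ≤ 4 * jump s m := fun m hm => by
    have h := hpos (m - 1).toNat
    rwa [Int.toNat_of_nonneg (by lia), sub_add_cancel] at h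
  rcases lt_trichotomy m 0 with h | rfl | h
  · rw [← neg_neg m, kernel_neg, jump_neg]
    exact hpos' _ (by lia)
  · simp [kernel, jump]
  · exact hpos' m h

/-! ### The evolution equation -/

/-- The image of the unit vector at `x` under `(-Δ)^s + V`. -/
def opUnit (s : ℝ) (V : ℤ → ℝ) (x : ℤ) : l2 := fracLaplacian s (unit x) + V x • unit x

theorem isSchrodingerOp_unit (s : ℝ) (V : ℤ → ℝ) (x : ℤ) :
    IsSchrodingerOp s V (unit x) (opUnit s V x) := by
  refine ⟨summable_of_ne_finset_zero (s := {x}) fun y hy => ?_, fun φ _ => ?_⟩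
  · rw [unit_apply, if_neg (by simpa using hy)]; ring
  · rw [schrodingerForm, opUnit, inner_add_left, real_inner_smul_left, unit_inner,
      tsum_eq_single x fun y hy => by rw [unit_apply, if_neg hy]; ring]
    rw [unit_apply, if_pos rfl, mul_one]

/-- `inner ℝ u (opUnit s V x)` stands for `(L_V u)(x)` and makes sense for every `u` in `l²`, in the
operator domain or not. -/
theorem hasSum_jump_mul {s : ℝ} (hs0 : 0 < s) (hs1 : s < 1) (V : ℤ → ℝ) (u : l2) (x : ℤ) :
    HasSum (fun y => jump s (y - x) * u y)
      ((holding s + V x) * u x - inner ℝ u (opUnit s V x)) := by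
  have h1 := hasSum_ite_eq x ((holding s + V x) * u x)
  refine (h1.sub (hasSum_mul_inner u (opUnit s V x))).congr_fun fun y => ?_
  rw [opUnit, lp.coeFn_add, lp.coeFn_smul, Pi.add_apply, Pi.smul_apply, smul_eq_mul, unit_apply,
    fracLaplacian_unit_apply hs0 hs1]
  split_ifs with h
  · subst h; simp [jump]; ring
  · ring

/-- Symmetry moves the increment of the semigroup onto the unit vector at `x`, which lies in the
operator domain; so nothing is asked of `f`. Only a right derivative results, which is enough for
the fundamental theorem of calculus. -/
theorem hasDerivWithinAt_semigroup {P : ℝ → l2 →L[ℝ] l2} (hP : IsSymmSubMarkovSemigroup P)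
    {s : ℝ} {V : ℤ → ℝ} (hgen : IsGeneratedBy P s V) (f : l2) (x : ℤ) {t : ℝ} (ht : 0 ≤ t) :
    HasDerivWithinAt (fun t => P t f x) (-inner ℝ (P t f) (opUnit s V x)) (Ioi t) t := by
  rw [hasDerivWithinAt_iff_tendsto_slope' self_notMem_Ioi]
  have h0 := (hgen _ _).2 (isSchrodingerOp_unit s V x)
  have hsub : Tendsto (fun r => r - t) (𝓝[>] t) (𝓝[>] 0) := by
    refine tendsto_nhdsWithin_iff.2 ⟨?_, ?_⟩
    · have : Continuous fun r : ℝ => r - t := by fun_prop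
      simpa using (this.tendsto t).mono_left nhdsWithin_le_nhds
    · filter_upwards [self_mem_nhdsWithin] with r hr
      exact mem_Ioi.2 (sub_pos.2 (mem_Ioi.1 hr))
  have h1 := ((innerSL ℝ (P t f)).continuous.tendsto _).comp (h0.comp hsub)
  simp only [innerSL_apply_apply, inner_neg_right] at h1
  refine h1.congr' ?_
  filter_upwards [self_mem_nhdsWithin] with r hr
  have hrt : 0 ≤ r - t := sub_nonneg.2 (le_of_lt hr)
  have e : P r f x = inner ℝ (P t f) (P (r - t) (unit x)) := by
    have := hP.map_add (r - t) t hrt ht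
    rw [sub_add_cancel] at this
    rw [this, ContinuousLinearMap.comp_apply, hP.apply_eq_inner hrt]
  simp only [Function.comp_apply, innerSL_apply_apply, inner_smul_right, inner_sub_right,
    slope_def_field, e, inner_unit]
  ring

/-! ### The energy estimate -/

/-- The pointwise dissipation of `∑ |u|^p` along the evolution. -/
def dissipation (s : ℝ) (V : ℤ → ℝ) (p : ℝ) (u : ℤ → ℝ) (x : ℤ) : ℝ≥0∞ :=
  ∑' y, ENNReal.ofReal (jump s (y - x) * bregman p (u x) (u y)) +
    ENNReal.ofReal (V x * |u x| ^ p)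

/-- The inflow of `|u|^p` at `x`. -/
def inflow (s p : ℝ) (u : ℤ → ℝ) (x : ℤ) : ℝ≥0∞ :=
  ∑' y, ENNReal.ofReal (jump s (y - x) * |u y| ^ p)

/-- The total jump rate. -/
def totalJump (s : ℝ) : ℝ≥0∞ := ∑' m, ENNReal.ofReal (jump s m)

theorem totalJump_ne_top {s : ℝ} (hs0 : 0 < s) (hs1 : s < 1) : totalJump s ≠ ⊤ :=
  ne_top_of_le_ne_top ENNReal.ofReal_ne_top (tsum_jump_le hs0 hs1)

theorem tsum_ofReal_jump_sub_right (s : ℝ) (x : ℤ) :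
    ∑' y, ENNReal.ofReal (jump s (y - x)) = totalJump s :=
  (Equiv.subRight x).tsum_eq fun m => ENNReal.ofReal (jump s m)

theorem summable_jump_sub {s : ℝ} (hs0 : 0 < s) (hs1 : s < 1) (x : ℤ) :
    Summable fun y => jump s (y - x) := by
  have h : ∑' y, ENNReal.ofReal (jump s (y - x)) ≠ ⊤ := by
    rw [tsum_ofReal_jump_sub_right]; exact totalJump_ne_top hs0 hs1
  simpa only [ENNReal.toReal_ofReal (jump_nonneg s _)] using ENNReal.summable_toReal h

theorem inflow_le {s : ℝ} {p : ℝ} (hp : 0 ≤ p) (u : l2) (x : ℤ) :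
    inflow s p u x ≤ totalJump s * ENNReal.ofReal (‖u‖ ^ p) := by
  rw [← tsum_ofReal_jump_sub_right s x, ← ENNReal.tsum_mul_right]
  refine ENNReal.tsum_le_tsum fun y => ?_
  rw [ENNReal.ofReal_mul (jump_nonneg s _)]
  gcongr
  exact abs_apply_le_norm u y

theorem holding_nonneg (s : ℝ) : 0 ≤ holding s := by
  refine mul_nonneg (by positivity) (setIntegral_nonneg measurableSet_Ioi fun t ht => ?_)
  have h1 := heatKernel_le_one (le_of_lt ht) 0
  have h2 : (0 : ℝ) < t := ht
  exact mul_nonneg (by positivity) (sub_nonneg.2 h1)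

/-- Expanding the Bregman sum, the right side exceeds the left by `p (holding s - Jt) |u x|^p + (p -
1) V x |u x|^p`, where `Jt` is the total jump rate. The first conjunct allows the time integral of
the right side to be read as a lower integral. -/
theorem dissipation_add_le {s : ℝ} (hs0 : 0 < s) (hs1 : s < 1) {V : ℤ → ℝ} (hV : ∀ x, 0 ≤ V x)
    {p : ℝ} (hp : 1 < p) (u : l2) (x : ℤ) :
    0 ≤ p * |u x| ^ (p - 2) * u x * inner ℝ u (opUnit s V x) + (inflow s p u x).toReal ∧
    dissipation s V p u x + totalJump s * ENNReal.ofReal (|u x| ^ p) ≤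
      ENNReal.ofReal (p * |u x| ^ (p - 2) * u x * inner ℝ u (opUnit s V x) +
        (inflow s p u x).toReal) := by
  have hJ := summable_jump_sub hs0 hs1 x
  set Jt := ∑' y, jump s (y - x) with hJt
  have hJt0 : 0 ≤ Jt := tsum_nonneg fun y => jump_nonneg s _
  have hJtE : totalJump s = ENNReal.ofReal Jt := by
    rw [← tsum_ofReal_jump_sub_right s x, hJt,
      ENNReal.ofReal_tsum_of_nonneg (fun y => jump_nonneg s _) hJ]
  have hJh : Jt ≤ holding s := by
    have h := tsum_jump_le hs0 hs1
    change totalJump s ≤ _ at h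
    rw [hJtE] at h
    exact (ENNReal.ofReal_le_ofReal_iff (holding_nonneg s)).1 h
  have hφ : Summable fun y => jump s (y - x) * |u y| ^ p :=
    Summable.of_nonneg_of_le
      (fun y => mul_nonneg (jump_nonneg s _) (Real.rpow_nonneg (abs_nonneg _) _))
      (fun y => mul_le_mul_of_nonneg_left
        (Real.rpow_le_rpow (abs_nonneg _) (abs_apply_le_norm u y) (by linarith))
        (jump_nonneg s _)) (hJ.mul_right (‖u‖ ^ p))
  have hQ : (inflow s p u x).toReal = ∑' y, jump s (y - x) * |u y| ^ p := by
    rw [inflow, ← ENNReal.ofReal_tsum_of_nonneg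
      (fun y => mul_nonneg (jump_nonneg s _) (Real.rpow_nonneg (abs_nonneg _) _)) hφ,
      ENNReal.toReal_ofReal
        (tsum_nonneg fun y => mul_nonneg (jump_nonneg s _) (Real.rpow_nonneg (abs_nonneg _) _))]
  have hB : HasSum (fun y => jump s (y - x) * bregman p (u x) (u y))
      (∑' y, jump s (y - x) * |u y| ^ p + Jt * ((p - 1) * |u x| ^ p) -
        p * |u x| ^ (p - 2) * u x *
          ((holding s + V x) * u x - inner ℝ u (opUnit s V x))) := by
    refine ((hφ.hasSum.add (hJ.hasSum.mul_right _)).sub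
      ((hasSum_jump_mul hs0 hs1 V u x).mul_left _)).congr_fun fun y => ?_
    rw [bregman]; ring
  have hB0 : ∀ y, 0 ≤ jump s (y - x) * bregman p (u x) (u y) := fun y =>
    mul_nonneg (jump_nonneg s _) (bregman_nonneg hp _ _)
  have hux : 0 ≤ |u x| ^ p := Real.rpow_nonneg (abs_nonneg _) _
  have hsq := abs_rpow_sub_two_mul_sq hp (u x)
  have e : p * |u x| ^ (p - 2) * u x * ((holding s + V x) * u x - inner ℝ u (opUnit s V x)) =
      p * (holding s + V x) * |u x| ^ p -
        p * |u x| ^ (p - 2) * u x * inner ℝ u (opUnit s V x) := by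
    rw [← hsq]; ring
  have k1 : 0 ≤ p * (holding s - Jt) * |u x| ^ p := by
    have : 0 ≤ holding s - Jt := sub_nonneg.2 hJh
    positivity
  have k2 : 0 ≤ (p - 1) * V x * |u x| ^ p := by
    have := hV x
    have : 0 ≤ p - 1 := by linarith
    positivity
  have key : ∑' y, jump s (y - x) * bregman p (u x) (u y) + V x * |u x| ^ p + Jt * |u x| ^ p ≤
      p * |u x| ^ (p - 2) * u x * inner ℝ u (opUnit s V x) + (inflow s p u x).toReal := by
    rw [hQ, hB.tsum_eq, e]
    linarith
  refine ⟨le_trans (add_nonneg (add_nonneg (tsum_nonneg hB0) (mul_nonneg (hV x) hux))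
    (mul_nonneg hJt0 hux)) key, ?_⟩
  rw [dissipation, ← ENNReal.ofReal_tsum_of_nonneg hB0 hB.summable, hJtE,
    ← ENNReal.ofReal_mul hJt0, ← ENNReal.ofReal_add (tsum_nonneg hB0) (mul_nonneg (hV x) hux),
    ← ENNReal.ofReal_add (add_nonneg (tsum_nonneg hB0) (mul_nonneg (hV x) hux))
      (mul_nonneg hJt0 hux)]
  exact ENNReal.ofReal_le_ofReal key

theorem measurable_dissipation {U : ℝ → ℤ → ℝ} (hU : ∀ x, Measurable fun t => U t x)
    (s : ℝ) (V : ℤ → ℝ) (p : ℝ) (x : ℤ) : Measurable fun t => dissipation s V p (U t) x := by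
  have hx := hU x
  refine Measurable.add (Measurable.tsum fun y => ?_) (by fun_prop)
  have hy := hU y
  simp only [bregman]
  fun_prop

theorem measurable_inflow {U : ℝ → ℤ → ℝ} (hU : ∀ x, Measurable fun t => U t x)
    (s p : ℝ) (x : ℤ) : Measurable fun t => inflow s p (U t) x := by
  refine Measurable.tsum fun y => ?_
  have hy := hU y
  fun_prop

variable {P : ℝ → l2 →L[ℝ] l2} (hP : IsSymmSubMarkovSemigroup P)

include hP in
theorem IsSymmSubMarkovSemigroup.measurable_max (f : l2) (x : ℤ) :
    Measurable fun t => P (max t 0) f x :=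
  ((continuous_apply_l2 x).comp (hP.continuous_max f)).measurable

include hP in
theorem lintegral_dissipation_add_le {s : ℝ} (hs0 : 0 < s) (hs1 : s < 1) {V : ℤ → ℝ}
    (hV : ∀ x, 0 ≤ V x) (hgen : IsGeneratedBy P s V) {p : ℝ} (hp : 1 < p) (f : l2) (x : ℤ)
    {T : ℝ} (hT : 0 ≤ T) :
    ∫⁻ t in Ioc 0 T, (dissipation s V p (P (max t 0) f) x +
        totalJump s * ENNReal.ofReal (|P (max t 0) f x| ^ p)) ≤
      ENNReal.ofReal (|f x| ^ p) + ∫⁻ t in Ioc 0 T, inflow s p (P (max t 0) f) x := by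
  set U : ℝ → l2 := fun t => P (max t 0) f with hUdef
  have hUc : Continuous U := hP.continuous_max f
  have hUx : Continuous fun t => U t x := (continuous_apply_l2 x).comp hUc
  set g : ℝ → ℝ := fun t =>
    p * |U t x| ^ (p - 2) * U t x * inner ℝ (U t) (opUnit s V x) with hg
  set Q : ℝ → ℝ := fun t => (inflow s p (U t) x).toReal with hQ
  -- For `p < 2` the factor `|a|^(p-2)` is singular at zero; continuity of the product comes from
  -- `|·|^p` being continuously differentiable.
  have hφ' : Continuous fun a : ℝ => p * |a| ^ (p - 2) * a := by
    have h : (fun a : ℝ => p * |a| ^ (p - 2) * a) = deriv fun a : ℝ => |a| ^ p := by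
      ext a; rw [(hasDerivAt_abs_rpow a hp).deriv]
    rw [h]
    exact (contDiff_norm_rpow (E := ℝ) hp).continuous_deriv le_rfl
  have hgc : Continuous g := (hφ'.comp hUx).mul (hUc.inner continuous_const)
  have hgint : ∫ t in Ioc 0 T, g t ≤ |f x| ^ p := by
    have hder : ∀ t ∈ Ioo (min 0 T) (max 0 T),
        HasDerivWithinAt (fun t => |U t x| ^ p) (-g t) (Ioi t) t := fun t ht => by
      rw [min_eq_left hT] at ht
      have h1 := hasDerivWithinAt_semigroup hP hgen f x ht.1.le
      have h2 := (hasDerivAt_abs_rpow (P t f x) hp).comp_hasDerivWithinAt t h1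
      have e : ∀ r, 0 < r → U r = P r f := fun r hr => by
        simp only [hUdef, max_eq_left hr.le]
      have h3 : HasDerivWithinAt (fun t => |U t x| ^ p) _ (Ioi t) t :=
        h2.congr (fun r hr => by
          simp only [Function.comp_apply, e r (ht.1.trans hr)]) (by
          simp only [Function.comp_apply, e t ht.1])
      refine h3.congr_deriv ?_
      simp only [hg, e t ht.1]
      ring
    have hFc : Continuous fun t => |U t x| ^ p :=
      hUx.abs.rpow_const fun t => Or.inr (by linarith)
    have h := intervalIntegral.integral_eq_sub_of_hasDeriv_right hFc.continuousOn hder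
      (hgc.neg.intervalIntegrable 0 T)
    rw [intervalIntegral.integral_neg, intervalIntegral.integral_of_le hT] at h
    have e0 : U 0 = f := by simp [hUdef, hP.map_zero]
    rw [e0] at h
    have := Real.rpow_nonneg (abs_nonneg (U T x)) p
    linarith
  have hUm : ∀ y, Measurable fun t => U t y := fun y => hP.measurable_max f y
  have hQm : Measurable Q := (measurable_inflow hUm s p x).ennreal_toReal
  have hQle : ∀ t, inflow s p (U t) x ≤ totalJump s * ENNReal.ofReal (‖f‖ ^ p) := fun t => by
    refine (inflow_le (by linarith) (U t) x).trans ?_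
    gcongr
    exact hP.contractive _ (le_max_right _ _) f
  have hctop : totalJump s * ENNReal.ofReal (‖f‖ ^ p) ≠ ⊤ :=
    ENNReal.mul_ne_top (totalJump_ne_top hs0 hs1) ENNReal.ofReal_ne_top
  have hQtop : ∀ t, inflow s p (U t) x ≠ ⊤ := fun t => ne_top_of_le_ne_top hctop (hQle t)
  have hQi : IntegrableOn Q (Ioc 0 T) :=
    Measure.integrableOn_of_bounded (M := (totalJump s * ENNReal.ofReal (‖f‖ ^ p)).toReal)
      measure_Ioc_lt_top.ne hQm.aestronglyMeasurable (Eventually.of_forall fun t => by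
        rw [Real.norm_of_nonneg ENNReal.toReal_nonneg]
        exact ENNReal.toReal_mono hctop (hQle t))
  have hgi : IntegrableOn g (Ioc 0 T) := (hgc.integrableOn_Icc).mono_set Ioc_subset_Icc_self
  have hpt := fun t => dissipation_add_le hs0 hs1 hV hp (U t) x
  calc _ ≤ ∫⁻ t in Ioc 0 T, ENNReal.ofReal (g t + Q t) := lintegral_mono fun t => (hpt t).2
    _ = ENNReal.ofReal (∫ t in Ioc 0 T, (g t + Q t)) :=
        (ofReal_integral_eq_lintegral_ofReal (hgi.add hQi) (Eventually.of_forall fun t => (hpt t).1)).symm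
    _ = ENNReal.ofReal ((∫ t in Ioc 0 T, g t) + ∫ t in Ioc 0 T, Q t) := by
        rw [integral_add hgi hQi]
    _ ≤ ENNReal.ofReal (∫ t in Ioc 0 T, g t) + ENNReal.ofReal (∫ t in Ioc 0 T, Q t) :=
        ENNReal.ofReal_add_le
    _ ≤ _ := by
        refine add_le_add (ENNReal.ofReal_le_ofReal hgint) ?_
        rw [ofReal_integral_eq_lintegral_ofReal hQi
          (Eventually.of_forall fun t => ENNReal.toReal_nonneg)]
        exact lintegral_mono fun t => (ENNReal.ofReal_toReal (hQtop t)).le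

theorem tsum_inflow (s : ℝ) {p : ℝ} (u : ℤ → ℝ) :
    ∑' x, inflow s p u x = totalJump s * ∑' y, ENNReal.ofReal (|u y| ^ p) := by
  simp only [inflow]
  rw [ENNReal.tsum_comm, ← ENNReal.tsum_mul_left]
  refine tsum_congr fun y => ?_
  simp only [ENNReal.ofReal_mul (jump_nonneg s _), ENNReal.tsum_mul_right]
  congr 1
  exact (Equiv.subLeft y).tsum_eq fun m => ENNReal.ofReal (jump s m)

include hP in
-- Summed over the sites, outflow and inflow are the same quantity `R`. It can be cancelled because
-- it is finite, which uses the bounded time window and contractivity in `ℓ^p`.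
theorem tsum_lintegral_dissipation_Ioc_le {s : ℝ} (hs0 : 0 < s) (hs1 : s < 1) {V : ℤ → ℝ}
    (hV : ∀ x, 0 ≤ V x) (hgen : IsGeneratedBy P s V) {p : ℝ} (hp : 1 < p) (f : l2)
    (hf : ∑' x, ENNReal.ofReal |f x| ^ p ≠ ⊤) {T : ℝ} (hT : 0 ≤ T) :
    ∑' x, ∫⁻ t in Ioc 0 T, dissipation s V p (P (max t 0) f) x ≤
      ∑' x, ENNReal.ofReal |f x| ^ p := by
  have hp0 : 0 ≤ p := by linarith
  have hpow : ∀ a : ℝ, ENNReal.ofReal (|a| ^ p) = ENNReal.ofReal |a| ^ p := fun a =>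
    (ENNReal.ofReal_rpow_of_nonneg (abs_nonneg a) hp0).symm
  have hUm := fun y => hP.measurable_max f y
  have hDm : ∀ x, Measurable fun t => dissipation s V p (P (max t 0) f) x := fun x =>
    measurable_dissipation hUm s V p x
  have hIm : ∀ x, Measurable fun t => inflow s p (P (max t 0) f) x := fun x =>
    measurable_inflow hUm s p x
  have hφm : ∀ x, Measurable fun t =>
      totalJump s * ENNReal.ofReal (|P (max t 0) f x| ^ p) := fun x =>
    ((measurable_abs.comp (hUm x)).pow_const p).ennreal_ofReal.const_mul _
  set R := ∫⁻ t in Ioc 0 T, totalJump s * ∑' y, ENNReal.ofReal (|P (max t 0) f y| ^ p) with hR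
  have hRtop : R ≠ ⊤ := by
    refine ne_top_of_le_ne_top ?_ (lintegral_mono fun t =>
      mul_le_mul_right (?_ : _ ≤ ∑' x, ENNReal.ofReal |f x| ^ p) _)
    · rw [lintegral_const]
      exact ENNReal.mul_ne_top (ENNReal.mul_ne_top (totalJump_ne_top hs0 hs1) hf)
        (by simp)
    · simp only [hpow]
      exact hP.tsum_rpow_apply_le (le_max_right t 0) hp.le f
  have h := ENNReal.tsum_le_tsum fun x =>
    lintegral_dissipation_add_le hP hs0 hs1 hV hgen hp f x hT
  have e1 : ∀ x, ∫⁻ t in Ioc 0 T, (dissipation s V p (P (max t 0) f) x +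
        totalJump s * ENNReal.ofReal (|P (max t 0) f x| ^ p)) =
      (∫⁻ t in Ioc 0 T, dissipation s V p (P (max t 0) f) x) +
        ∫⁻ t in Ioc 0 T, totalJump s * ENNReal.ofReal (|P (max t 0) f x| ^ p) := fun x =>
    lintegral_add_left (hDm x) _
  simp only [e1, ENNReal.tsum_add] at h
  rw [← lintegral_tsum fun x => (hφm x).aemeasurable,
    ← lintegral_tsum fun x => (hIm x).aemeasurable] at h
  simp only [tsum_inflow, ENNReal.tsum_mul_left] at h
  rw [← hR] at h
  simpa only [hpow] using (ENNReal.add_le_add_iff_right hRtop).1 h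

include hP in
/-- The total dissipation of `∑ |P_t f|^p` is at most `∑ |f|^p`. -/
theorem tsum_lintegral_dissipation_le {s : ℝ} (hs0 : 0 < s) (hs1 : s < 1) {V : ℤ → ℝ}
    (hV : ∀ x, 0 ≤ V x) (hgen : IsGeneratedBy P s V) {p : ℝ} (hp : 1 < p) (f : l2)
    (hf : ∑' x, ENNReal.ofReal |f x| ^ p ≠ ⊤) :
    ∑' x, ∫⁻ t in Ioi 0, dissipation s V p (P (max t 0) f) x ≤
      ∑' x, ENNReal.ofReal |f x| ^ p := by
  have hDm : ∀ {S : Set ℝ} x, AEMeasurable (fun t => dissipation s V p (P (max t 0) f) x)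
      (volume.restrict S) := fun x =>
    (measurable_dissipation (fun y => hP.measurable_max f y) s V p x).aemeasurable
  have hU : Ioi (0 : ℝ) = ⋃ n : ℕ, Ioc 0 (n : ℝ) := by
    ext t
    simp only [mem_Ioi, mem_iUnion, mem_Ioc, exists_and_left]
    exact ⟨fun h => ⟨h, exists_nat_ge t⟩, fun h => h.1⟩
  rw [← lintegral_tsum hDm, hU, setLIntegral_iUnion_of_directed]
  · refine iSup_le fun n => ?_
    rw [lintegral_tsum hDm]
    exact tsum_lintegral_dissipation_Ioc_le hP hs0 hs1 hV hgen hp f hf n.cast_nonneg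
  · refine Monotone.directed_le fun m n hmn => ?_
    exact Ioc_subset_Ioc_right (by exact_mod_cast hmn)

/-! ### The square function -/

/-- The constant in the pointwise bound of the modified gradient. -/
def gradConst (p : ℝ) : ℝ := 4 / (p - 1) ^ 2

theorem modGrad_sq_add_le {s : ℝ} (hs0 : 0 < s) (hs1 : s < 1) {V : ℤ → ℝ} (hV : ∀ x, 0 ≤ V x)
    {p : ℝ} (hp1 : 1 < p) (hp2 : p ≤ 2) (u : ℤ → ℝ) (x : ℤ) :
    modGrad s u x ^ 2 + ENNReal.ofReal |√(V x) * u x| ^ 2 ≤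
      ENNReal.ofReal (gradConst p) * ENNReal.ofReal |u x| ^ (2 - p) * dissipation s V p u x := by
  have hp : 0 < p - 1 := by linarith
  -- The factor 4 of `gradConst` comes from `kernel_le_jump` and `(p - 1)^2` from the Bregman bound;
  -- the potential term needs only a constant at least one.
  have hC : 1 ≤ gradConst p := by
    rw [gradConst, le_div_iff₀ (by positivity)]
    nlinarith
  have hu : 0 ≤ |u x| ^ (2 - p) := Real.rpow_nonneg (abs_nonneg _) _
  rw [dissipation, mul_add, ENNReal.ofReal_rpow_of_nonneg (abs_nonneg _) (by linarith),
    ← ENNReal.ofReal_mul (by linarith)]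
  refine add_le_add ?_ ?_
  · rw [modGrad, ← ENNReal.rpow_natCast, ← ENNReal.rpow_mul]
    norm_num
    rw [← ENNReal.tsum_mul_left]
    refine le_trans (ENNReal.tsum_le_tsum fun y => ?_) (ENNReal.tsum_comp_le_tsum_of_injective
      (Subtype.val_injective (p := fun y : ℤ => |u x| > |u y|)) _)
    obtain ⟨y, hy⟩ := y
    simp only
    rw [← ENNReal.ofReal_mul (by positivity)]
    refine ENNReal.ofReal_le_ofReal ?_
    have h1 := sq_sub_le_bregman hp1 hp2 hy
    rw [← le_div_iff₀' (by positivity)] at h1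
    have hj := jump_nonneg s (y - x)
    calc kernel s (y - x) * (u x - u y) ^ 2
        ≤ 4 * jump s (y - x) * (|u x| ^ (2 - p) * bregman p (u x) (u y) / (p - 1) ^ 2) :=
          mul_le_mul (kernel_le_jump hs0 hs1 _) h1 (sq_nonneg _) (by positivity)
      _ = _ := by rw [gradConst]; ring
  · rw [← ENNReal.ofReal_pow (abs_nonneg _), ← ENNReal.ofReal_mul (by positivity)]
    refine ENNReal.ofReal_le_ofReal ?_
    have e : |u x| ^ (2 - p) * |u x| ^ p = u x ^ 2 := by
      rw [← Real.rpow_add_of_nonneg (abs_nonneg _) (by linarith) (by linarith), sub_add_cancel,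
        Real.rpow_two, sq_abs]
    have e2 : gradConst p * |u x| ^ (2 - p) * (V x * |u x| ^ p) =
        gradConst p * (V x * u x ^ 2) := by rw [← e]; ring
    rw [sq_abs, mul_pow, Real.sq_sqrt (hV x), e2]
    exact le_mul_of_one_le_left (mul_nonneg (hV x) (sq_nonneg _)) hC

include hP in
theorem squareFunction_le {s : ℝ} (hs0 : 0 < s) (hs1 : s < 1) {V : ℤ → ℝ} (hV : ∀ x, 0 ≤ V x)
    {p : ℝ} (hp1 : 1 < p) (hp2 : p ≤ 2) (f : l2) (x : ℤ) :
    squareFunction s V P f x ≤ (ENNReal.ofReal (gradConst p) * maximalFun P f x ^ (2 - p) *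
      ∫⁻ t in Ioi 0, dissipation s V p (P (max t 0) f) x) ^ (1 / 2 : ℝ) := by
  rw [squareFunction]
  gcongr
  rw [← lintegral_const_mul _ (measurable_dissipation (fun y => hP.measurable_max f y) s V p x)]
  refine setLIntegral_mono' measurableSet_Ioi fun t (ht : 0 < t) => ?_
  rw [max_eq_left ht.le]
  refine (modGrad_sq_add_le hs0 hs1 hV hp1 hp2 (P t f) x).trans ?_
  gcongr
  exact hP.ofReal_abs_apply_le_maximalFun ht.le f x

/-- The constant of the square function estimate. -/
def squareConst (p : ℝ) : ℝ≥0∞ :=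
  (ENNReal.ofReal (gradConst p) ^ (p / 2) * doobConst p ^ (1 - p / 2)) ^ (1 / p)

theorem squareConst_ne_top {p : ℝ} (hp1 : 1 < p) (hp2 : p ≤ 2) : squareConst p ≠ ⊤ := by
  have h1 : 0 ≤ p / 2 := by linarith
  have h2 : 0 ≤ 1 - p / 2 := by linarith
  have h3 : 0 ≤ 1 / p := by positivity
  exact ENNReal.rpow_ne_top_of_nonneg h3 (ENNReal.mul_ne_top
    (ENNReal.rpow_ne_top_of_nonneg h1 ENNReal.ofReal_ne_top)
    (ENNReal.rpow_ne_top_of_nonneg h2 (doobConst_ne_top hp1)))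

include hP in
theorem lqNorm_squareFunction_le {s : ℝ} (hs0 : 0 < s) (hs1 : s < 1) {V : ℤ → ℝ}
    (hV : ∀ x, 0 ≤ V x) (hgen : IsGeneratedBy P s V) {p : ℝ} (hp1 : 1 < p) (hp2 : p ≤ 2)
    (f : l2) (hf : ∑' x, ENNReal.ofReal |f x| ^ p ≠ ⊤) :
    lqNorm p (squareFunction s V P f) ≤
      squareConst p * (∑' x, ENNReal.ofReal |f x| ^ p) ^ (1 / p) := by
  have hp0 : 0 < p := by linarith
  have h1 : 0 ≤ p / 2 := by linarith
  have h2 : 0 ≤ 1 - p / 2 := by linarith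
  set S := ∑' x, ENNReal.ofReal |f x| ^ p
  set C := ENNReal.ofReal (gradConst p)
  set E : ℤ → ℝ≥0∞ := fun x => ∫⁻ t in Ioi 0, dissipation s V p (P (max t 0) f) x
  rw [lqNorm, squareConst, ← ENNReal.mul_rpow_of_nonneg _ _ (by positivity)]
  gcongr
  calc ∑' x, squareFunction s V P f x ^ p
      ≤ ∑' x, C ^ (p / 2) * ((maximalFun P f x ^ p) ^ (1 - p / 2) * E x ^ (p / 2)) := by
        refine ENNReal.tsum_le_tsum fun x => ?_
        have h := ENNReal.rpow_le_rpow (squareFunction_le hP hs0 hs1 hV hp1 hp2 f x) hp0.le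
        refine h.trans_eq ?_
        -- This identity of exponents makes the maximal function enter Hölder's inequality through
        -- its `p`-th power.
        have e : (2 - p) * (p / 2) = p * (1 - p / 2) := by ring
        rw [← ENNReal.rpow_mul, one_div_mul_eq_div, ENNReal.mul_rpow_of_nonneg _ _ h1,
          ENNReal.mul_rpow_of_nonneg _ _ h1, ← ENNReal.rpow_mul, ← ENNReal.rpow_mul, e, mul_assoc]
    _ ≤ C ^ (p / 2) * ((∑' x, maximalFun P f x ^ p) ^ (1 - p / 2) * (∑' x, E x) ^ (p / 2)) := by
        rw [ENNReal.tsum_mul_left]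
        exact mul_le_mul_right (tsum_rpow_mul_rpow_le _ _ h2 h1 (by ring)) _
    _ ≤ C ^ (p / 2) * ((doobConst p * S) ^ (1 - p / 2) * S ^ (p / 2)) := by
        gcongr
        · exact hP.tsum_maximalFun_rpow_le hp1 f
        · exact tsum_lintegral_dissipation_le hP hs0 hs1 hV hgen hp1 f hf
    _ = C ^ (p / 2) * doobConst p ^ (1 - p / 2) * S := by
        rw [ENNReal.mul_rpow_of_nonneg _ _ h2, mul_assoc, mul_assoc,
          ← ENNReal.rpow_add_of_nonneg _ _ h2 h1, sub_add_cancel, ENNReal.rpow_one]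

theorem tsum_ofReal_abs_rpow_eq {q : ℝ} (hq : 0 < q)
    (f : lp (fun _ : ℤ => ℝ) (ENNReal.ofReal q)) :
    ∑' x, ENNReal.ofReal |f x| ^ q = ENNReal.ofReal (‖f‖ ^ q) := by
  have hr : (ENNReal.ofReal q).toReal = q := ENNReal.toReal_ofReal hq.le
  have h := lp.hasSum_norm (by rw [hr]; exact hq) f
  rw [hr] at h
  simp only [ENNReal.ofReal_rpow_of_nonneg (abs_nonneg _) hq.le]
  rw [← h.tsum_eq, ENNReal.ofReal_tsum_of_nonneg
    (fun x => Real.rpow_nonneg (norm_nonneg _) q) h.summable]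
  rfl

end FracSchrodinger

end

open FracSchrodinger in
theorem corollary2p3 (q : ℝ) (hq1 : 1 < q) (hq2 : q ≤ 2) :
    ∃ c : ℝ, 0 < c ∧
      ∀ (s : ℝ) (V : ℤ → ℝ) (P : ℝ → l2 →L[ℝ] l2),
        0 < s → s < 1 → (∀ x, 0 ≤ V x) →
        IsSymmSubMarkovSemigroup P → IsGeneratedBy P s V →
        ∀ f : lp (fun _ : ℤ => ℝ) (ENNReal.ofReal q),
          lqNorm q (squareFunction s V P (toL2 hq2 f)) ≤ ENNReal.ofReal (c * ‖f‖) := by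
  have hq0 : 0 < q := by linarith
  -- The added 1 only ensures that the constant is positive.
  refine ⟨(squareConst q).toReal + 1, by positivity, fun s V P hs0 hs1 hV hP hgen f => ?_⟩
  have hS : ∑' x, ENNReal.ofReal |toL2 hq2 f x| ^ q = ENNReal.ofReal (‖f‖ ^ q) :=
    tsum_ofReal_abs_rpow_eq hq0 f
  refine (lqNorm_squareFunction_le hP hs0 hs1 hV hgen hq1 hq2 _
    (hS ▸ ENNReal.ofReal_ne_top)).trans ?_
  have hn : 0 ≤ ‖f‖ := lp.norm_nonneg' f
  rw [hS, ENNReal.ofReal_rpow_of_nonneg (by positivity) (by positivity), ← Real.rpow_mul hn,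
    mul_one_div_cancel hq0.ne', Real.rpow_one, ENNReal.ofReal_mul (by positivity)]
  gcongr
  rw [ENNReal.ofReal_add ENNReal.toReal_nonneg zero_le_one,
    ENNReal.ofReal_toReal (squareConst_ne_top hq1 hq2)]
  exact le_self_add
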